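/- Let $W=(W(f))_{f\in L_2(0,1)}$ be Gaussian white noise on $(0,1)$, that is, a centred Gaussian process with $\mathbf E[W(f)W(g)]=\int_0^1 fg\,dt$; we write $W(f)=\int_0^1 f\,dw$. For $\varepsilon>0$ and $S\in L_2(0,1)$ one observes $dY_\varepsilon(t)=S(t)\,dt+\varepsilon\,dw(t)$, $t\in[0,1]$. Let $(\phi_j)_{j\ge1}$ be an orthonormal system in $L_2(0,1)$, and put $\theta_j=\int_0^1 S\phi_j\,dt$ and $y_{\varepsilon j}=\int_0^1\phi_j\,dY_\varepsilon=\theta_j+\varepsilon W(\phi_j)$. For each $\varepsilon>0$ let $\varkappa_{\varepsilon j}$, $j\ge 1$, be real numbers with $\rho_\varepsilon^2=\sum_{j\ge1}\varkappa_{\varepsilon j}^2<\infty$. Put $A_\varepsilon=\varepsilon^{-4}\sum_{j\ge1}\varkappa_{\varepsilon j}^4$, $k_\varepsilon=\sup\{k\ge1:\sum_{1\le j<k}\varkappa_{\varepsilon j}^2\le\frac12\rho_\varepsilon^2\}$ and $\varkappa_\varepsilon^2=\varkappa_{\varepsilon k_\varepsilon}^2$. Here $[a]$ is the integer part of $a$,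 and $a_\varepsilon\asymp b_\varepsilon$ means that the ratio $a_\varepsilon/b_\varepsilon$ lies between two positive constants for all sufficiently small $\varepsilon>0$. Assume: * A1. For each $\varepsilon>0$ the sequence $j\mapsto\varkappa_{\varepsilon j}^2$ is non-increasing. * A2. There are constants $C_1,C_2>0$ such that $C_1<A_\varepsilon<C_2$ for all $\varepsilon>0$. * A3. There are $C_1>0$ and $\lambda>1$ such that $\varkappa^2_{\varepsilon,[(1+\delta)k_\varepsilon]}<C_1(1+\delta)^{-\lambda}\varkappa_\varepsilon^2$ for all $\delta>0$ and all $\varepsilon>0$. * A4. $\varkappa_{\varepsilon1}^2\asymp\varkappa_\varepsilon^2$ as $\varepsilon\to0$, and for every $c>1$ there is $C>0$ such that $\varkappa^2_{\varepsilon,[ck_\varepsilon]}\ge C\varkappa_\varepsilon^2$ for all $\varepsilon>0$. Let $0<r<1/2$, $0<2\omega<1-2r$, and suppose that $k_\varepsilon\asymp\varepsilon^{-4+8r+4\omega}$ as $\varepsilon\to0$. Consider the test statistics $T_\varepsilon=\varepsilon^{-2}\sum_{j\ge1}\varkappa_{\varepsilon j}^2y_{\varepsilon j}^2-\rho_\varepsilon^2$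 and the tests $L_\varepsilon=\mathbf 1\{A_\varepsilon^{-1/2}T_\varepsilon>x_\varepsilon\}$ with arbitrary real critical values $x_\varepsilon$, and let $\alpha(L_\varepsilon)=\mathbf E_0L_\varepsilon$ and $\beta(L_\varepsilon,S)=\mathbf E_S(1-L_\varepsilon)$ be their error probabilities under the zero signal and under the signal $S$. A family $S_\varepsilon\in L_2(0,1)$, $\varepsilon>0$, is called $\varepsilon^{-2\omega}$-LD consistent if for every choice of $x_\varepsilon$ with $\varepsilon^{4\omega}\log\alpha(L_\varepsilon)\to0$ as $\varepsilon\to0$ there is $c>0$ such that $|\log\beta(L_\varepsilon,S_\varepsilon)|\ge c\,\varepsilon^{-4\omega}$ for all sufficiently small $\varepsilon>0$ (with $|\log0|=\infty$). Let $S_\varepsilon\in L_2(0,1)$ with $\|S_\varepsilon\|\asymp\varepsilon^{2r}$ as $\varepsilon\to0$, and let $\theta_{\varepsilon j}=\int_0^1S_\varepsilon\phi_j\,dt$. Then the family $S_\varepsilon$ is $\varepsilon^{-2\omega}$-LD consistent if and only if there are $c_1,c_2,\varepsilon_0>0$ such that $$\sum_{j\ge1,\ j<c_2k_\varepsilon}|\theta_{\varepsilon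 j}|^2>c_1\varepsilon^{4r}\qquad\text{for all }0<\varepsilon<\varepsilon_0 .$$ -/

import Mathlib

open MeasureTheory ProbabilityTheory Filter Asymptotics Topology

noncomputable section

namespace SignalDetection

/-- The real Hilbert space `L₂(0,1)`. -/
abbrev L2 : Type := Lp ℝ 2 ((volume : Measure ℝ).restrict (Set.Ioo 0 1))

/-- `W` is a Gaussian white noise on `(0,1)`: a centred Gaussian process indexed by `L₂(0,1)` with
covariance `E[W f · W g] = ∫₀¹ f g`. The variable `W f` is the stochastic integral `∫₀¹ f dw`. -/
structure IsWhiteNoise {Ω : Type*} [MeasurableSpace Ω] (P : Measure Ω) (W : L2 → Ω → ℝ) :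
    Prop where
  isGaussianProcess : IsGaussianProcess W P
  mean_eq_zero : ∀ f, ∫ ω, W f ω ∂P = 0
  covariance_eq : ∀ f g, ∫ ω, W f ω * W g ω ∂P = inner ℝ f g

/-- The Fourier coefficient `θ_j = ∫₀¹ S φ_j dt`. -/
def fourierCoeff (φ : ℕ+ → L2) (S : L2) (j : ℕ+) : ℝ := inner ℝ S (φ j)

/-- The observation `y_{εj} = ∫₀¹ φ_j dY_ε = θ_j + ε ξ_j`, `ξ_j = ∫₀¹ φ_j dw`, in the model
`dY_ε(t) = S(t) dt + ε dw(t)`. -/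
def observation {Ω : Type*} (W : L2 → Ω → ℝ) (φ : ℕ+ → L2) (ε : ℝ) (S : L2) (j : ℕ+) (ω : Ω) : ℝ :=
  fourierCoeff φ S j + ε * W (φ j) ω

/-- `ρ_ε² = ∑_{j ≥ 1} ϰ_{εj}²`. -/
def rhoSq (ϰ : ℝ → ℕ+ → ℝ) (ε : ℝ) : ℝ := ∑' j, ϰ ε j ^ 2

/-- `A_ε = ε⁻⁴ ∑_{j ≥ 1} ϰ_{εj}⁴`. -/
def normA (ϰ : ℝ → ℕ+ → ℝ) (ε : ℝ) : ℝ := (ε ^ 4)⁻¹ * ∑' j, ϰ ε j ^ 4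

/-- `k_ε = sup {k ≥ 1 : ∑_{j < k} ϰ_{εj}² ≤ ρ_ε² / 2}`. -/
def cutoff (ϰ : ℝ → ℕ+ → ℝ) (ε : ℝ) : ℕ :=
  sSup {k : ℕ | 1 ≤ k ∧ ∑ j ∈ Finset.Ico 1 k, ϰ ε j.toPNat' ^ 2 ≤ rhoSq ϰ ε / 2}

/-- `ϰ_ε² = ϰ_{ε, k_ε}²`. -/
def kappaSq (ϰ : ℝ → ℕ+ → ℝ) (ε : ℝ) : ℝ := ϰ ε (cutoff ϰ ε).toPNat' ^ 2

/-- The conditions A1–A4 on the coefficients `ϰ_{εj}²`. The field `summable` is the convergence of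
the series `ρ_ε²` that enters the test statistic. -/
structure Conditions (ϰ : ℝ → ℕ+ → ℝ) : Prop where
  summable : ∀ ε > 0, Summable fun j => ϰ ε j ^ 2
  A1 : ∀ ε > 0, Antitone fun j => ϰ ε j ^ 2
  A2 : ∃ C₁ > 0, ∃ C₂ > 0, ∀ ε > 0, C₁ < normA ϰ ε ∧ normA ϰ ε < C₂
  A3 : ∃ C₁ > 0, ∃ lam > (1 : ℝ), ∀ δ > (0 : ℝ), ∀ ε > 0,
    ϰ ε (⌊(1 + δ) * (cutoff ϰ ε : ℝ)⌋₊).toPNat' ^ 2 < C₁ * (1 + δ) ^ (-lam) * kappaSq ϰ ε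
  A4_first : (fun ε => ϰ ε 1 ^ 2) =Θ[𝓝[>] 0] fun ε => kappaSq ϰ ε
  A4_tail : ∀ c > (1 : ℝ), ∃ C > 0, ∀ ε > 0,
    C * kappaSq ϰ ε ≤ ϰ ε (⌊c * (cutoff ϰ ε : ℝ)⌋₊).toPNat' ^ 2

/-- The test statistic `T_ε(Y_ε) = ε⁻² ∑_j ϰ_{εj}² y_{εj}² - ρ_ε²` as a function of the
observations `y = (y_{εj})_j`. -/
def testStat (ϰ : ℝ → ℕ+ → ℝ) (ε : ℝ) (y : ℕ+ → ℝ) : ℝ :=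
  (ε ^ 2)⁻¹ * ∑' j, ϰ ε j ^ 2 * y j ^ 2 - rhoSq ϰ ε

/-- The rejection region of the test `L_ε = 1{A_ε^{-1/2} T_ε > x}` with critical value `x`. -/
def rejects (ϰ : ℝ → ℕ+ → ℝ) (ε x : ℝ) : Set (ℕ+ → ℝ) :=
  {y | x < (√(normA ϰ ε))⁻¹ * testStat ϰ ε y}

/-- Type I error probability `α(L_ε) = E₀ L_ε`. -/
def typeI {Ω : Type*} [MeasurableSpace Ω] (P : Measure Ω) (W : L2 → Ω → ℝ) (φ : ℕ+ → L2)
    (ϰ : ℝ → ℕ+ → ℝ) (ε x : ℝ) : ℝ :=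
  P.real {ω | (fun j => observation W φ ε 0 j ω) ∈ rejects ϰ ε x}

/-- Type II error probability `β(L_ε, S) = E_S (1 - L_ε)`. -/
def typeII {Ω : Type*} [MeasurableSpace Ω] (P : Measure Ω) (W : L2 → Ω → ℝ) (φ : ℕ+ → L2)
    (ϰ : ℝ → ℕ+ → ℝ) (ε x : ℝ) (S : L2) : ℝ :=
  P.real {ω | (fun j => observation W φ ε S j ω) ∉ rejects ϰ ε x}

/-- The family of alternatives `S_ε` is `R_ε`-LD consistent for the tests generated by the
statistics `T_ε`: for every choice of the critical values `x_ε` such that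
`R_ε⁻² log α(L_ε) → 0`, one has `|log β(L_ε, S_ε)| = Ω(R_ε²)` as `ε → 0`.
Here `|log 0| = ∞`, which is why `α > 0` is required and `β = 0` is allowed separately. -/
def IsLDConsistent {Ω : Type*} [MeasurableSpace Ω] (P : Measure Ω) (W : L2 → Ω → ℝ)
    (φ : ℕ+ → L2) (ϰ : ℝ → ℕ+ → ℝ) (R : ℝ → ℝ) (S : ℝ → L2) : Prop :=
  ∀ x : ℝ → ℝ,
    (∀ᶠ ε in 𝓝[>] 0, 0 < typeI P W φ ϰ ε (x ε)) →
    Tendsto (fun ε => (R ε ^ 2)⁻¹ * Real.log (typeI P W φ ϰ ε (x ε))) (𝓝[>] 0) (𝓝 0) →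
    ∃ c > 0, ∀ᶠ ε in 𝓝[>] 0,
      typeII P W φ ϰ ε (x ε) (S ε) = 0 ∨
        c * R ε ^ 2 ≤ |Real.log (typeII P W φ ϰ ε (x ε) (S ε))|

end SignalDetection

end

/-! Divide the observations by `ε`. With weights `b_j = ϰ_{εj}²/ε²`, means `m_j = θ_j/ε` and
independent standard Gaussian `ξ_j`, a test rejects when `∑ b_j (ξ_j + m_j)² - ∑ b_j > t`. Here `∑
b_j² = A_ε` is bounded above and below, and the signal enters the bounds only through its energy `E
= ∑ b_j m_j²`. Put `R = ε^(-2ω)`.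

Exponential moments at `s` of order `R` are available because `R · max b_j → 0`. Indeed A1–A4 force
the weight at `k_ε` to be of exact order `k_ε^(-1/2)`, hence of order `ε^(2-4r-2ω)`, the largest
weight has the same order, and `2ω < 1 - 2r` makes the product vanish. Chernoff bounds together with
a second-moment lower bound then show that `log α = o(R²)` forces `t ≤ o(R)`
(`eventually_critical_le`), and conversely (`tendsto_log_typeI`).

Consistency is therefore equivalent to `E ≥ c R`. If this holds, a Chernoff bound on the lower tail
gives `β ≤ exp(-c' R²)` (`isLDConsistent_of_energy`). If it fails along a sequence, thresholds
slightly above `2E` are still `o(R)` there, yet `β ≥ 1/2` (`energy_of_isLDConsistent`).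

Finally, `E ≥ c R` is a statement about low frequencies (`energy_lower_iff`). For `j < c₂ k_ε` the
weights are comparable to the one at `k_ε`, while beyond that A3 makes them so small, for large
`c₂`, that the remaining energy is at most half of `c R`. -/

namespace SignalDetection

/-! ### Exponential moments of weighted noncentral chi-square sums -/

lemma integral_exp_mul_add_sq_gaussianReal {c : ℝ} (hc : 2 * c < 1) (m : ℝ) :
    ∫ x, Real.exp (c * (x + m) ^ 2) ∂(gaussianReal 0 1) =
      Real.exp (c * m ^ 2 / (1 - 2 * c)) / √(1 - 2 * c) := by
  have hp : 0 < 1 - 2 * c := by linarith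
  rw [integral_gaussianReal_eq_integral_smul one_ne_zero]
  -- Completing the square leaves a Gaussian density of variance `1/(1 - 2c)`, up to a constant
  -- factor.
  have key : ∀ x : ℝ, gaussianPDFReal 0 1 x • Real.exp (c * (x + m) ^ 2) =
      ((√(2 * Real.pi))⁻¹ * Real.exp (c * m ^ 2 / (1 - 2 * c))) *
        Real.exp (-((1 - 2 * c) / 2) * (x - 2 * c * m / (1 - 2 * c)) ^ 2) := by
    intro x
    simp only [gaussianPDFReal_def, smul_eq_mul, NNReal.coe_one, mul_one, sub_zero]
    rw [mul_assoc, mul_assoc, ← Real.exp_add, ← Real.exp_add]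
    congr 2
    field_simp
    ring
  simp_rw [key]
  rw [integral_const_mul,
    integral_sub_right_eq_self (fun x => Real.exp (-((1 - 2 * c) / 2) * x ^ 2)),
    integral_gaussian]
  have : Real.pi / ((1 - 2 * c) / 2) = 2 * Real.pi / (1 - 2 * c) := by field_simp
  rw [this, Real.sqrt_div (by positivity)]
  have : √(2 * Real.pi) ≠ 0 := by positivity
  field_simp

lemma inv_sqrt_eq_exp {y : ℝ} (hy : 0 < y) : 1 / √y = Real.exp (-(Real.log y / 2)) := by
  rw [Real.exp_neg, Real.exp_half, Real.exp_log hy, one_div]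

/-- From `|log(1 - y) + y| ≤ y²/(1 - y)` at `y = 2x`; the condition `x ≤ 1/4` keeps `1 - y ≥ 1/2`,
which yields the constants 4 and 2. -/
lemma exp_div_sqrt_le {x : ℝ} (h0 : 0 ≤ x) (h1 : x ≤ 1 / 4) (m : ℝ) :
    Real.exp (x * m ^ 2 / (1 - 2 * x)) / √(1 - 2 * x) ≤
      Real.exp (x + 4 * x ^ 2 + 2 * (x * m ^ 2)) := by
  have hp : 1 / 2 ≤ 1 - 2 * x := by linarith
  have hp0 : 0 < 1 - 2 * x := by linarith
  rw [div_eq_mul_one_div, inv_sqrt_eq_exp hp0, ← Real.exp_add]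
  apply Real.exp_le_exp.2
  have hlog := Real.abs_log_sub_add_sum_range_le (x := 2 * x)
    (by rw [abs_of_nonneg (by linarith)]; linarith) 1
  simp only [Finset.range_one, Finset.sum_singleton, Nat.cast_zero, zero_add, pow_one, div_one,
    abs_of_nonneg (show (0 : ℝ) ≤ 2 * x by linarith)] at hlog
  have h2 : (2 * x) ^ (1 + 1) / (1 - 2 * x) ≤ 8 * x ^ 2 := by
    rw [div_le_iff₀ hp0, one_add_one_eq_two]
    nlinarith [mul_nonneg (sq_nonneg x) (sub_nonneg.2 hp)]
  have h3 := (abs_le.1 hlog).1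
  have h4 : x * m ^ 2 / (1 - 2 * x) ≤ 2 * (x * m ^ 2) := by
    have : 0 ≤ x * m ^ 2 := by positivity
    rw [div_le_iff₀ hp0]; nlinarith
  linarith

/-- Only the first two terms of the series of `-log(1 - 2x)` are kept, and the nonnegative
contribution of the mean is dropped. -/
lemma le_exp_div_sqrt {x : ℝ} (h0 : 0 ≤ x) (h1 : 2 * x < 1) (m : ℝ) :
    Real.exp (x + x ^ 2) ≤ Real.exp (x * m ^ 2 / (1 - 2 * x)) / √(1 - 2 * x) := by
  have hp0 : 0 < 1 - 2 * x := by linarith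
  rw [div_eq_mul_one_div, inv_sqrt_eq_exp hp0, ← Real.exp_add]
  apply Real.exp_le_exp.2
  have h4 : 0 ≤ x * m ^ 2 / (1 - 2 * x) := by positivity
  have hs := Real.hasSum_pow_div_log_of_abs_lt_one (x := 2 * x)
    (by rw [abs_of_nonneg (by linarith)]; linarith)
  have := hs.summable.sum_le_tsum (Finset.range 2) (fun i _ => by positivity)
  rw [hs.tsum_eq] at this
  simp [Finset.sum_range_succ] at this
  nlinarith

/-- The logarithm is bounded by `log(1 + y) ≥ 2y/(y + 2)`; the factor 1/2 on the mean comes from `1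
+ 2x ≤ 2`. -/
lemma exp_div_sqrt_neg_le {x : ℝ} (h0 : 0 ≤ x) (h1 : x ≤ 1 / 2) (m : ℝ) :
    Real.exp (-x * m ^ 2 / (1 - 2 * -x)) / √(1 - 2 * -x) ≤
      Real.exp (-x + x ^ 2 - 1 / 2 * (x * m ^ 2)) := by
  have hp0 : 0 < 1 - 2 * -x := by linarith
  rw [div_eq_mul_one_div, inv_sqrt_eq_exp hp0, ← Real.exp_add]
  apply Real.exp_le_exp.2
  have hlog := Real.le_log_one_add_of_nonneg (x := 2 * x) (by linarith)
  rw [show 1 + 2 * x = 1 - 2 * -x by ring] at hlog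
  have h2 : 2 * x - 2 * x ^ 2 ≤ 2 * (2 * x) / (2 * x + 2) := by
    rw [le_div_iff₀ (by linarith)]; nlinarith [pow_nonneg h0 3]
  have h4 : -x * m ^ 2 / (1 - 2 * -x) ≤ - (1 / 2 * (x * m ^ 2)) := by
    have : 0 ≤ x * m ^ 2 := by positivity
    rw [div_le_iff₀ hp0]; nlinarith
  linarith

section

variable {Ω ι : Type*} [MeasurableSpace Ω] {P : Measure Ω} {ξ : ι → Ω → ℝ}

/-- The moment generating function of a finite weighted noncentral chi-square sum. -/
lemma mgf_weighted_sq (hind : iIndepFun ξ P) (hlaw : ∀ j, HasLaw (ξ j) (gaussianReal 0 1) P)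
    (b m : ι → ℝ) (F : Finset ι) {s : ℝ} (hs : ∀ j ∈ F, 2 * (s * b j) < 1) :
    mgf (fun ω => ∑ j ∈ F, b j * (ξ j ω + m j) ^ 2) P s =
      ∏ j ∈ F, Real.exp (s * b j * m j ^ 2 / (1 - 2 * (s * b j))) / √(1 - 2 * (s * b j)) := by
  have h1 : iIndepFun (fun j ω => b j * (ξ j ω + m j) ^ 2) P :=
    hind.comp (fun j x => b j * (x + m j) ^ 2) (fun j => by fun_prop)
  have hm : ∀ j, AEMeasurable (fun ω => b j * (ξ j ω + m j) ^ 2) P := fun j => by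
    have := (hlaw j).aemeasurable
    fun_prop
  have h2 := h1.mgf_sum₀ (t := s) hm F
  have : (fun ω => ∑ j ∈ F, b j * (ξ j ω + m j) ^ 2) =
      ∑ j ∈ F, fun ω => b j * (ξ j ω + m j) ^ 2 := by ext; simp
  rw [this, h2]
  refine Finset.prod_congr rfl fun j hj => ?_
  rw [← integral_exp_mul_add_sq_gaussianReal (hs j hj), ← (hlaw j).map_eq,
    integral_map (hlaw j).aemeasurable (by fun_prop)]
  simp only [mgf, mul_assoc]

/-- A non-integrable exponential would have integral 0 by convention, whereas the product formula is
strictly positive. -/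
lemma integrable_exp_weighted_sq (hind : iIndepFun ξ P)
    (hlaw : ∀ j, HasLaw (ξ j) (gaussianReal 0 1) P)
    (b m : ι → ℝ) (F : Finset ι) {s : ℝ} (hs : ∀ j ∈ F, 2 * (s * b j) < 1) :
    Integrable (fun ω => Real.exp (s * ∑ j ∈ F, b j * (ξ j ω + m j) ^ 2)) P := by
  by_contra h
  have h1 := mgf_weighted_sq hind hlaw b m F hs
  rw [mgf, integral_undef h] at h1
  refine (Finset.prod_pos fun j hj => ?_).ne h1
  have := hs j hj
  have : 0 < 1 - 2 * (s * b j) := by linarith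
  positivity

lemma mgf_weighted_sq_le (hind : iIndepFun ξ P) (hlaw : ∀ j, HasLaw (ξ j) (gaussianReal 0 1) P)
    {b : ι → ℝ} (m : ι → ℝ) (F : Finset ι) {s : ℝ} (hs0 : 0 ≤ s) (hb : ∀ j, 0 ≤ b j)
    (hs : ∀ j, s * b j ≤ 1 / 4) :
    mgf (fun ω => ∑ j ∈ F, b j * (ξ j ω + m j) ^ 2) P s ≤
      Real.exp (s * ∑ j ∈ F, b j + 4 * s ^ 2 * ∑ j ∈ F, b j ^ 2
        + 2 * s * ∑ j ∈ F, b j * m j ^ 2) := by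
  rw [mgf_weighted_sq hind hlaw b m F fun j _ => by linarith [hs j]]
  simp_rw [Finset.mul_sum, ← Finset.sum_add_distrib, Real.exp_sum]
  refine Finset.prod_le_prod (fun j _ => by positivity) fun j _ => ?_
  refine (exp_div_sqrt_le (mul_nonneg hs0 (hb j)) (hs j) (m j)).trans_eq ?_
  ring_nf

lemma le_mgf_weighted_sq (hind : iIndepFun ξ P) (hlaw : ∀ j, HasLaw (ξ j) (gaussianReal 0 1) P)
    {b : ι → ℝ} (m : ι → ℝ) (F : Finset ι) {s : ℝ} (hs0 : 0 ≤ s) (hb : ∀ j, 0 ≤ b j)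
    (hs : ∀ j, s * b j ≤ 1 / 4) :
    Real.exp (s * ∑ j ∈ F, b j + s ^ 2 * ∑ j ∈ F, b j ^ 2) ≤
      mgf (fun ω => ∑ j ∈ F, b j * (ξ j ω + m j) ^ 2) P s := by
  rw [mgf_weighted_sq hind hlaw b m F fun j _ => by linarith [hs j]]
  simp_rw [Finset.mul_sum, ← Finset.sum_add_distrib, Real.exp_sum]
  refine Finset.prod_le_prod (fun j _ => by positivity) fun j _ => ?_
  refine Eq.trans_le ?_
    (le_exp_div_sqrt (mul_nonneg hs0 (hb j)) (by linarith [hs j]) (m j))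
  ring_nf

lemma mgf_neg_weighted_sq_le (hind : iIndepFun ξ P)
    (hlaw : ∀ j, HasLaw (ξ j) (gaussianReal 0 1) P)
    {b : ι → ℝ} (m : ι → ℝ) (F : Finset ι) {s : ℝ} (hs0 : 0 ≤ s) (hb : ∀ j, 0 ≤ b j)
    (hs : ∀ j, s * b j ≤ 1 / 4) :
    mgf (fun ω => ∑ j ∈ F, b j * (ξ j ω + m j) ^ 2) P (-s) ≤
      Real.exp (-s * ∑ j ∈ F, b j + s ^ 2 * ∑ j ∈ F, b j ^ 2
        + -(s / 2) * ∑ j ∈ F, b j * m j ^ 2) := by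
  rw [mgf_weighted_sq hind hlaw b m F fun j _ => by nlinarith [mul_nonneg hs0 (hb j)]]
  simp_rw [Finset.mul_sum, ← Finset.sum_add_distrib, Real.exp_sum, neg_mul s]
  refine Finset.prod_le_prod (fun j _ => by positivity) fun j _ => ?_
  refine (exp_div_sqrt_neg_le (mul_nonneg hs0 (hb j)) (by linarith [hs j]) (m j)).trans_eq ?_
  ring_nf

/-! ### Tail bounds for infinite weighted sums -/

/-- The central sum has finite expectation `∑ b_j`, and `(ξ + m)² ≤ 2ξ² + 2m²` handles the means. -/
lemma ae_summable_weighted_sq [Countable ι] (hlaw : ∀ j, HasLaw (ξ j) (gaussianReal 0 1) P)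
    {b m : ι → ℝ} (hb : ∀ j, 0 ≤ b j) (hbs : Summable b)
    (hbm : Summable fun j => b j * m j ^ 2) :
    ∀ᵐ ω ∂P, Summable fun j => b j * (ξ j ω + m j) ^ 2 := by
  have hsq : ∀ j, ∫⁻ ω, ENNReal.ofReal (b j * ξ j ω ^ 2) ∂P = ENNReal.ofReal (b j) := by
    intro j
    have h2 : MemLp (ξ j) 2 P := by
      have := (hlaw j).aemeasurable
      have h := memLp_id_gaussianReal (μ := 0) (v := 1) 2
      rw [← (hlaw j).map_eq] at h
      exact (memLp_map_measure_iff (by fun_prop) this).1 h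
    rw [← ofReal_integral_eq_lintegral_ofReal (h2.integrable_sq.const_mul _)
      (ae_of_all _ fun ω => mul_nonneg (hb j) (sq_nonneg _)), integral_const_mul]
    have h3 : ∫ ω, ξ j ω ^ 2 ∂P = ∫ x, x ^ 2 ∂(gaussianReal 0 1) := by
      rw [← (hlaw j).map_eq, integral_map (hlaw j).aemeasurable (by fun_prop)]
    have h4 := variance_fun_id_gaussianReal (μ := 0) (v := 1)
    rw [variance_of_integral_eq_zero (by fun_prop) (by simp)] at h4
    rw [h3, h4]; simp
  have hfin : ∫⁻ ω, ∑' j, ENNReal.ofReal (b j * ξ j ω ^ 2) ∂P ≠ ⊤ := by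
    rw [lintegral_tsum fun j => by have := (hlaw j).aemeasurable; fun_prop]
    simp_rw [hsq]
    exact hbs.tsum_ofReal_ne_top
  have hae := ae_lt_top' (AEMeasurable.tsum fun j => by
    have := (hlaw j).aemeasurable; fun_prop) hfin
  filter_upwards [hae] with ω hω
  have h1 : Summable fun j => b j * ξ j ω ^ 2 := by
    have := ENNReal.summable_toReal hω.ne
    refine this.congr fun j => ?_
    exact ENNReal.toReal_ofReal (mul_nonneg (hb j) (sq_nonneg _))
  refine Summable.of_nonneg_of_le (fun j => mul_nonneg (hb j) (sq_nonneg _)) (fun j => ?_)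
    ((h1.mul_left 2).add (hbm.mul_left 2))
  nlinarith [hb j, mul_nonneg (hb j) (sq_nonneg (ξ j ω - m j))]

/-- The event is covered by the increasing union of the same events for finite partial sums, so a
Chernoff bound uniform in `F` passes to the limit. -/
lemma measureReal_tsum_weighted_sq_gt_le [Countable ι] [IsProbabilityMeasure P]
    (hind : iIndepFun ξ P)
    (hlaw : ∀ j, HasLaw (ξ j) (gaussianReal 0 1) P)
    {b m : ι → ℝ} (hb : ∀ j, 0 ≤ b j) (hbs : Summable b) (hb2 : Summable fun j => b j ^ 2)
    (hbm : Summable fun j => b j * m j ^ 2) {s : ℝ} (hs0 : 0 ≤ s) (hs : ∀ j, s * b j ≤ 1 / 4)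
    (u : ℝ) :
    P.real {ω | u < ∑' j, b j * (ξ j ω + m j) ^ 2} ≤
      Real.exp (-s * u + (s * ∑' j, b j + 4 * s ^ 2 * ∑' j, b j ^ 2
        + 2 * s * ∑' j, b j * m j ^ 2)) := by
  set K := Real.exp (-s * u + (s * ∑' j, b j + 4 * s ^ 2 * ∑' j, b j ^ 2
        + 2 * s * ∑' j, b j * m j ^ 2)) with hK
  let E : Finset ι → Set Ω := fun F => {ω | u < ∑ j ∈ F, b j * (ξ j ω + m j) ^ 2}
  have hterm : ∀ ω j, 0 ≤ b j * (ξ j ω + m j) ^ 2 := fun ω j => mul_nonneg (hb j) (sq_nonneg _)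
  have hsub : {ω | u < ∑' j, b j * (ξ j ω + m j) ^ 2} ⊆ ⋃ F, E F := by
    intro ω hω
    simp only [Set.mem_ofPred_eq] at hω
    by_cases hsum : Summable fun j => b j * (ξ j ω + m j) ^ 2
    · obtain ⟨F, hF⟩ := (hsum.hasSum.eventually (lt_mem_nhds hω)).exists
      exact Set.mem_iUnion.2 ⟨F, hF⟩
    -- A divergent sum has the default value 0, which is the partial sum over `∅`; no almost sure
    -- convergence is needed here.
    · rw [tsum_eq_zero_of_not_summable hsum] at hω
      exact Set.mem_iUnion.2 ⟨∅, by simpa [E] using hω⟩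
  have hmono : Monotone E := by
    intro F G hFG ω hω
    exact lt_of_lt_of_le hω (Finset.sum_le_sum_of_subset_of_nonneg hFG fun j _ _ => hterm ω j)
  have hE : ∀ F, P (E F) ≤ ENNReal.ofReal K := by
    intro F
    rw [← ofReal_measureReal]
    refine ENNReal.ofReal_le_ofReal ?_
    calc P.real (E F) ≤ P.real {ω | u ≤ ∑ j ∈ F, b j * (ξ j ω + m j) ^ 2} :=
          measureReal_mono fun ω (hω : u < _) => hω.le
      _ ≤ Real.exp (-s * u) * mgf (fun ω => ∑ j ∈ F, b j * (ξ j ω + m j) ^ 2) P s :=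
          measure_ge_le_exp_mul_mgf u hs0
            (integrable_exp_weighted_sq hind hlaw b m F fun j _ => by linarith [hs j])
      _ ≤ Real.exp (-s * u) * _ :=
          mul_le_mul_of_nonneg_left (mgf_weighted_sq_le hind hlaw m F hs0 hb hs)
            (Real.exp_pos _).le
      _ ≤ K := by
          rw [← Real.exp_add, hK]
          gcongr
          · exact hbs.sum_le_tsum F fun j _ => hb j
          · exact hb2.sum_le_tsum F fun j _ => sq_nonneg _
          · exact hbm.sum_le_tsum F fun j _ => mul_nonneg (hb j) (sq_nonneg _)
  have := (measure_mono hsub).trans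
    ((hmono.directed_le.measure_iUnion).trans_le (iSup_le hE))
  exact ENNReal.toReal_le_of_le_ofReal (Real.exp_pos _).le this

/-- Partial sums lie below the full sum almost surely, so each `F` gives a Chernoff bound, and the
bounds converge. Here almost sure summability matters: a default value 0 would enlarge the event. -/
lemma measureReal_tsum_weighted_sq_le_le [Countable ι] [IsProbabilityMeasure P]
    (hind : iIndepFun ξ P)
    (hlaw : ∀ j, HasLaw (ξ j) (gaussianReal 0 1) P)
    {b m : ι → ℝ} (hb : ∀ j, 0 ≤ b j) (hbs : Summable b) (hb2 : Summable fun j => b j ^ 2)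
    (hbm : Summable fun j => b j * m j ^ 2) {s : ℝ} (hs0 : 0 ≤ s) (hs : ∀ j, s * b j ≤ 1 / 4)
    (u : ℝ) :
    P.real {ω | ∑' j, b j * (ξ j ω + m j) ^ 2 ≤ u} ≤
      Real.exp (s * u + (-s * ∑' j, b j + s ^ 2 * ∑' j, b j ^ 2
        + -(s / 2) * ∑' j, b j * m j ^ 2)) := by
  have hbound : ∀ F : Finset ι, P.real {ω | ∑' j, b j * (ξ j ω + m j) ^ 2 ≤ u} ≤
      Real.exp (s * u + (-s * ∑ j ∈ F, b j + s ^ 2 * ∑ j ∈ F, b j ^ 2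
        + -(s / 2) * ∑ j ∈ F, b j * m j ^ 2)) := by
    intro F
    calc P.real {ω | ∑' j, b j * (ξ j ω + m j) ^ 2 ≤ u}
        ≤ P.real {ω | ∑ j ∈ F, b j * (ξ j ω + m j) ^ 2 ≤ u} := by
          refine ENNReal.toReal_mono (measure_ne_top _ _) (measure_mono_ae ?_)
          filter_upwards [ae_summable_weighted_sq hlaw hb hbs hbm] with ω hω
            (h : ∑' j, b j * (ξ j ω + m j) ^ 2 ≤ u)
          exact (hω.sum_le_tsum F fun j _ => mul_nonneg (hb j) (sq_nonneg _)).trans h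
      _ ≤ Real.exp (-(-s) * u) * mgf (fun ω => ∑ j ∈ F, b j * (ξ j ω + m j) ^ 2) P (-s) :=
          measure_le_le_exp_mul_mgf u (by linarith)
            (integrable_exp_weighted_sq hind hlaw b m F
              fun j _ => by nlinarith [mul_nonneg hs0 (hb j)])
      _ ≤ Real.exp (-(-s) * u) * _ :=
          mul_le_mul_of_nonneg_left (mgf_neg_weighted_sq_le hind hlaw m F hs0 hb hs)
            (Real.exp_pos _).le
      _ = _ := by rw [← Real.exp_add, neg_neg]
  refine ge_of_tendsto' (x := (atTop : Filter (Finset ι))) ?_ hbound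
  refine (Real.continuous_exp.tendsto _).comp (Tendsto.const_add _ ?_)
  exact ((hbs.hasSum.const_mul _).add (hb2.hasSum.const_mul _)).add (hbm.hasSum.const_mul _)

/-- A lower bound on upper tail probabilities through exponential moments. -/
lemma sq_mgf_div_le_measureReal [IsProbabilityMeasure P] {X : Ω → ℝ} {s u : ℝ}
    (hs : 0 ≤ s) (hX : AEMeasurable X P)
    (h1 : Integrable (fun ω => Real.exp (s * X ω)) P)
    (h2 : Integrable (fun ω => Real.exp (2 * s * X ω)) P)
    (hu : 2 * Real.exp (s * u) ≤ mgf X P s) :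
    mgf X P s ^ 2 / (4 * mgf X P (2 * s)) ≤ P.real {ω | u < X ω} := by
  have hM1 : 0 < mgf X P s := mgf_pos h1
  have hM2 : 0 < mgf X P (2 * s) := mgf_pos h2
  set M := mgf X P s
  set N := mgf X P (2 * s)
  set E := {ω | u < X ω} with hE
  have hEm : NullMeasurableSet E P := nullMeasurableSet_lt aemeasurable_const hX
  have hint : Integrable (E.indicator fun _ => (1 : ℝ)) P :=
    (integrable_const 1).indicator₀ hEm
  -- On `E` this is the inequality of arithmetic and geometric means. Integrating it gives `M ≤ M/2
  -- + M/4 + (N/M) P(E)`, because `exp(su) ≤ M/2`.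
  have hpt : ∀ ω, Real.exp (s * X ω) ≤ Real.exp (s * u) + (M / (4 * N)) * Real.exp (2 * s * X ω)
      + (N / M) * E.indicator (fun _ => (1 : ℝ)) ω := by
    intro ω
    by_cases hω : ω ∈ E
    · rw [Set.indicator_of_mem hω]
      have e : Real.exp (2 * s * X ω) = Real.exp (s * X ω) ^ 2 := by
        rw [← Real.exp_nat_mul]; congr 1; push_cast; ring
      rw [e]
      have := Real.exp_pos (s * u)
      have hsq : Real.exp (s * X ω) ≤
          M / (4 * N) * Real.exp (s * X ω) ^ 2 + N / M * 1 := by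
        have : M / (4 * N) * Real.exp (s * X ω) ^ 2 + N / M * 1 - Real.exp (s * X ω)
          = (M * Real.exp (s * X ω) - 2 * N) ^ 2 / (4 * N * M) := by field_simp; ring
        have h : 0 ≤ (M * Real.exp (s * X ω) - 2 * N) ^ 2 / (4 * N * M) := by positivity
        linarith
      linarith
    · have : X ω ≤ u := not_lt.1 hω
      have h3 : Real.exp (s * X ω) ≤ Real.exp (s * u) :=
        Real.exp_le_exp.2 (mul_le_mul_of_nonneg_left this hs)
      rw [Set.indicator_of_notMem hω]
      have : 0 ≤ M / (4 * N) * Real.exp (2 * s * X ω) := by positivity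
      linarith
  have hI := integral_mono h1 (((integrable_const (Real.exp (s * u))).add
    (h2.const_mul (M / (4 * N)))).add (hint.const_mul (N / M))) hpt
  simp only [Pi.add_apply] at hI
  rw [integral_add (by fun_prop) (by fun_prop), integral_add (by fun_prop) (by fun_prop),
    integral_const_mul, integral_const_mul, integral_indicator₀ hEm] at hI
  simp only [integral_const, probReal_univ, smul_eq_mul, one_mul, mul_one,
    measureReal_restrict_apply_univ] at hI
  change M ≤ Real.exp (s * u) + M / (4 * N) * N + N / M * P.real E at hI
  have e1 : M / (4 * N) * N = M / 4 := by field_simp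
  have h5 : M / 4 ≤ N / M * P.real E := by linarith
  rw [div_le_iff₀ (by positivity)]
  have := mul_le_mul_of_nonneg_left h5 hM1.le
  have e2 : M * (N / M * P.real E) = N * P.real E := by field_simp
  nlinarith

/-- In `mgf(s)²/(4 mgf(2s))` the linear exponents cancel and the quadratic ones leave `2s² - 4(2s)²
= -14s²`. The bound 1/8 on `s b_j` is what the moment at `2s` requires, and `ht` makes `2 exp(su) ≤
mgf(s)` for a large finite `F`. -/
lemma le_measureReal_tsum_weighted_sq_gt [Countable ι] [IsProbabilityMeasure P]
    (hind : iIndepFun ξ P)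
    (hlaw : ∀ j, HasLaw (ξ j) (gaussianReal 0 1) P)
    {b : ι → ℝ} (hb : ∀ j, 0 ≤ b j) (hbs : Summable b) (hb2 : Summable fun j => b j ^ 2)
    {s : ℝ} (hs0 : 0 ≤ s) (hs : ∀ j, s * b j ≤ 1 / 8)
    {t : ℝ} (ht : s * t + Real.log 2 < s ^ 2 * ∑' j, b j ^ 2) :
    1 / 4 * Real.exp (-14 * s ^ 2 * ∑' j, b j ^ 2) ≤
      P.real {ω | ∑' j, b j + t < ∑' j, b j * (ξ j ω) ^ 2} := by
  have hlim : Tendsto (fun F : Finset ι => s * ∑ j ∈ F, b j + s ^ 2 * ∑ j ∈ F, b j ^ 2) atTop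
      (𝓝 (s * ∑' j, b j + s ^ 2 * ∑' j, b j ^ 2)) :=
    (hbs.hasSum.const_mul _).add (hb2.hasSum.const_mul _)
  obtain ⟨F, hF⟩ := (hlim.eventually (lt_mem_nhds
    (show s * (∑' j, b j + t) + Real.log 2 < _ by linarith))).exists
  set X : Ω → ℝ := fun ω => ∑ j ∈ F, b j * (ξ j ω + (0 : ι → ℝ) j) ^ 2 with hXdef
  have hs4 : ∀ j, s * b j ≤ 1 / 4 := fun j => by linarith [hs j]
  have hs2 : ∀ j, 2 * s * b j ≤ 1 / 4 := fun j => by linarith [hs j]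
  have hlow := le_mgf_weighted_sq hind hlaw 0 F hs0 hb hs4
  have hup := mgf_weighted_sq_le hind hlaw 0 F (mul_nonneg zero_le_two hs0) hb hs2
  have hX : AEMeasurable X P := by
    refine Finset.aemeasurable_fun_sum F fun j _ => ?_
    have := (hlaw j).aemeasurable
    fun_prop
  have hu : 2 * Real.exp (s * (∑' j, b j + t)) ≤ mgf X P s := by
    refine le_trans ?_ hlow
    rw [show 2 * Real.exp (s * (∑' j, b j + t)) =
      Real.exp (s * (∑' j, b j + t) + Real.log 2) by
        rw [Real.exp_add, Real.exp_log two_pos, mul_comm]]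
    exact Real.exp_le_exp.2 hF.le
  have i2 := integrable_exp_weighted_sq hind hlaw b 0 F (s := 2 * s)
      (fun j _ => by linarith [hs2 j])
  have hmain := sq_mgf_div_le_measureReal hs0 hX
    (integrable_exp_weighted_sq hind hlaw b 0 F fun j _ => by linarith [hs j]) i2 hu
  have hsub : P.real {ω | ∑' j, b j + t < X ω} ≤
      P.real {ω | ∑' j, b j + t < ∑' j, b j * (ξ j ω) ^ 2} := by
    refine ENNReal.toReal_mono (measure_ne_top _ _) (measure_mono_ae ?_)
    filter_upwards [ae_summable_weighted_sq (m := 0) hlaw hb hbs (by simp)]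
      with ω hω (h : _ < X ω)
    refine lt_of_lt_of_le h ?_
    simp only [Pi.zero_apply, add_zero] at hω
    simp only [hXdef, Pi.zero_apply, add_zero]
    exact hω.sum_le_tsum F fun j _ => mul_nonneg (hb j) (sq_nonneg _)
  refine le_trans ?_ (hmain.trans hsub)
  have hN : 0 < mgf X P (2 * s) := mgf_pos i2
  rw [le_div_iff₀ (by positivity)]
  have hle := hb2.sum_le_tsum F fun j _ => sq_nonneg (b j)
  calc 1 / 4 * Real.exp (-14 * s ^ 2 * ∑' j, b j ^ 2) * (4 * mgf X P (2 * s))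
      = Real.exp (-14 * s ^ 2 * ∑' j, b j ^ 2) * mgf X P (2 * s) := by ring
    _ ≤ Real.exp (-14 * s ^ 2 * ∑ j ∈ F, b j ^ 2) * _ := by
        refine mul_le_mul (Real.exp_le_exp.2 ?_) hup hN.le (Real.exp_pos _).le
        nlinarith [sq_nonneg s]
    _ = Real.exp (s * ∑ j ∈ F, b j + s ^ 2 * ∑ j ∈ F, b j ^ 2) ^ 2 := by
        rw [← Real.exp_add, ← Real.exp_nat_mul]
        congr 1
        simp
        ring
    _ ≤ mgf X P s ^ 2 := by gcongr

end

end SignalDetection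

noncomputable section

namespace SignalDetection

/-! ### White noise along an orthonormal system -/

section

variable {Ω : Type*} [MeasurableSpace Ω] {P : Measure Ω} {W : L2 → Ω → ℝ}
  {φ : ℕ+ → L2} {ϰ : ℝ → ℕ+ → ℝ}

lemma IsWhiteNoise.hasLaw [IsProbabilityMeasure P] (hW : IsWhiteNoise P W) {f : L2}
    (hf : ‖f‖ = 1) : HasLaw (W f) (gaussianReal 0 1) P where
  aemeasurable := hW.isGaussianProcess.aemeasurable f
  map_eq := by
    rw [(hW.isGaussianProcess.hasGaussianLaw_eval f).map_eq_gaussianReal, hW.mean_eq_zero,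
      variance_of_integral_eq_zero (hW.isGaussianProcess.aemeasurable f) (hW.mean_eq_zero f)]
    have := hW.covariance_eq f f
    rw [real_inner_self_eq_norm_sq, hf] at this
    simp_rw [sq, this]
    simp

lemma IsWhiteNoise.iIndepFun [IsProbabilityMeasure P] (hW : IsWhiteNoise P W)
    (hφ : Orthonormal ℝ φ) : iIndepFun (fun j => W (φ j)) P := by
  -- The criterion that uncorrelated jointly Gaussian families are independent is applied to
  -- families indexed by one point.
  have h : ProbabilityTheory.iIndepFun (fun (j : ℕ+) ω (_ : Unit) => W (φ j) ω) P := by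
    refine IsGaussianProcess.iIndepFun_of_covariance_eq_zero (S := fun _ => Unit)
      (X := fun j _ => W (φ j))
      (hW.isGaussianProcess.comp_right fun p : (_ : ℕ+) × Unit => φ p.1)
      (fun j _ => hW.isGaussianProcess.aemeasurable _) fun i j hij _ _ => ?_
    rw [covariance_eq_sub (hW.isGaussianProcess.hasGaussianLaw_eval _).memLp_two
      (hW.isGaussianProcess.hasGaussianLaw_eval _).memLp_two]
    simp only [hW.mean_eq_zero, mul_zero, sub_zero]
    exact (hW.covariance_eq _ _).trans (hφ.2 hij)
  exact h.comp (fun _ g => g ()) fun _ => measurable_pi_apply ()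

/-! ### Normalised form of the tests -/

/-- The normalised weights `ε⁻² ϰ_{εj}²`. -/
def weight (ϰ : ℝ → ℕ+ → ℝ) (ε : ℝ) (j : ℕ+) : ℝ := ϰ ε j ^ 2 / ε ^ 2

/-- The normalised means `θ_j / ε`. -/
def normMean (φ : ℕ+ → L2) (ε : ℝ) (S : L2) (j : ℕ+) : ℝ := fourierCoeff φ S j / ε

/-- The contribution of the signal to the expectation of the normalised test statistic. -/
def energy (φ : ℕ+ → L2) (ϰ : ℝ → ℕ+ → ℝ) (ε : ℝ) (S : L2) : ℝ :=
  ∑' j, weight ϰ ε j * normMean φ ε S j ^ 2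

lemma weight_nonneg (ϰ : ℝ → ℕ+ → ℝ) (ε : ℝ) (j : ℕ+) : 0 ≤ weight ϰ ε j := by
  unfold weight; positivity

lemma tsum_weight_sq (ϰ : ℝ → ℕ+ → ℝ) (ε : ℝ) : ∑' j, weight ϰ ε j ^ 2 = normA ϰ ε := by
  rw [normA, ← tsum_mul_left]
  refine tsum_congr fun j => ?_
  unfold weight
  rw [div_pow, ← pow_mul, ← pow_mul, div_eq_inv_mul]

/-- Since `T_ε` is `ε²` times the centred normalised sum, writing the critical value as `t ε²/√A_ε`
leaves the threshold `t`. -/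
lemma mem_rejects_iff {Ω : Type*} {W : L2 → Ω → ℝ} {ε : ℝ} (hε : 0 < ε) (hA : 0 < normA ϰ ε) (t : ℝ) (S : L2) (ω : Ω) :
    (fun j => observation W φ ε S j ω) ∈ rejects ϰ ε (t * ε ^ 2 / √(normA ϰ ε)) ↔
      ∑' j, weight ϰ ε j + t <
        ∑' j, weight ϰ ε j * (W (φ j) ω + normMean φ ε S j) ^ 2 := by
  have h1 : ∑' j, ϰ ε j ^ 2 * observation W φ ε S j ω ^ 2 =
      ε ^ 4 * ∑' j, weight ϰ ε j * (W (φ j) ω + normMean φ ε S j) ^ 2 := by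
    rw [← tsum_mul_left]
    refine tsum_congr fun j => ?_
    simp only [observation, weight, normMean]
    field_simp
    ring
  have h2 : rhoSq ϰ ε = ε ^ 2 * ∑' j, weight ϰ ε j := by
    rw [rhoSq, ← tsum_mul_left]
    refine tsum_congr fun j => ?_
    simp only [weight]
    field_simp
  have hA' : 0 < √(normA ϰ ε) := Real.sqrt_pos.2 hA
  simp only [rejects, testStat, Set.mem_ofPred_eq]
  rw [h1, h2, div_eq_inv_mul, mul_lt_mul_iff_right₀ (by positivity)]
  set Q := ∑' j, weight ϰ ε j * (W (φ j) ω + normMean φ ε S j) ^ 2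
  have h3 : (ε ^ 2)⁻¹ * (ε ^ 4 * Q) = Q * ε ^ 2 := by field_simp
  rw [h3, mul_comm (ε ^ 2) (∑' j, weight ϰ ε j), ← sub_mul,
    mul_lt_mul_iff_left₀ (by positivity), lt_sub_iff_add_lt']

lemma typeI_eq {ε : ℝ} (hε : 0 < ε) (hA : 0 < normA ϰ ε) (t : ℝ) :
    typeI P W φ ϰ ε (t * ε ^ 2 / √(normA ϰ ε)) =
      P.real {ω | ∑' j, weight ϰ ε j + t < ∑' j, weight ϰ ε j * W (φ j) ω ^ 2} := by
  unfold typeI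
  simp_rw [mem_rejects_iff hε hA]
  simp [normMean, fourierCoeff]

lemma typeII_eq {ε : ℝ} (hε : 0 < ε) (hA : 0 < normA ϰ ε) (t : ℝ) (S : L2) :
    typeII P W φ ϰ ε (t * ε ^ 2 / √(normA ϰ ε)) S =
      P.real {ω | ∑' j, weight ϰ ε j * (W (φ j) ω + normMean φ ε S j) ^ 2 ≤
        ∑' j, weight ϰ ε j + t} := by
  unfold typeII
  simp_rw [mem_rejects_iff hε hA, not_lt]

end

/-! ### Summability and the energy of the signal -/

section

variable {φ : ℕ+ → L2} {ϰ : ℝ → ℕ+ → ℝ}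

lemma Conditions.weight_antitone (hϰ : Conditions ϰ) {ε : ℝ} (hε : 0 < ε) :
    Antitone (weight ϰ ε) := fun _ _ hij =>
  div_le_div_of_nonneg_right (hϰ.A1 ε hε hij) (by positivity)

lemma Conditions.weight_le_one (hϰ : Conditions ϰ) {ε : ℝ} (hε : 0 < ε) (j : ℕ+) :
    weight ϰ ε j ≤ weight ϰ ε 1 := hϰ.weight_antitone hε one_le

lemma Conditions.summable_weight (hϰ : Conditions ϰ) {ε : ℝ} (hε : 0 < ε) :
    Summable (weight ϰ ε) := (hϰ.summable ε hε).div_const _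

lemma Conditions.summable_weight_sq (hϰ : Conditions ϰ) {ε : ℝ} (hε : 0 < ε) :
    Summable fun j => weight ϰ ε j ^ 2 :=
  Summable.of_nonneg_of_le (fun _ => sq_nonneg _) (fun j => by
    rw [sq]
    exact mul_le_mul_of_nonneg_right (hϰ.weight_le_one hε j) (weight_nonneg ϰ ε j))
    ((hϰ.summable_weight hε).mul_left (weight ϰ ε 1))

lemma Conditions.normA_pos (hϰ : Conditions ϰ) {ε : ℝ} (hε : 0 < ε) : 0 < normA ϰ ε := by
  obtain ⟨C₁, h1, C₂, -, h⟩ := hϰ.A2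
  exact h1.trans (h ε hε).1

lemma summable_fourierCoeff_sq (hφ : Orthonormal ℝ φ) (S : L2) :
    Summable fun j => fourierCoeff φ S j ^ 2 := by
  refine (hφ.inner_products_summable (x := S)).congr fun j => ?_
  rw [Real.norm_eq_abs, sq_abs, real_inner_comm, fourierCoeff]

lemma tsum_fourierCoeff_sq_le (hφ : Orthonormal ℝ φ) (S : L2) :
    ∑' j, fourierCoeff φ S j ^ 2 ≤ ‖S‖ ^ 2 := by
  refine (tsum_congr fun j => ?_).trans_le (hφ.tsum_inner_products_le (x := S))
  rw [Real.norm_eq_abs, sq_abs, real_inner_comm, fourierCoeff]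

lemma Conditions.summable_energy (hϰ : Conditions ϰ) (hφ : Orthonormal ℝ φ) {ε : ℝ} (hε : 0 < ε)
    (S : L2) : Summable fun j => weight ϰ ε j * normMean φ ε S j ^ 2 := by
  refine Summable.of_nonneg_of_le (fun j => mul_nonneg (weight_nonneg ϰ ε j) (sq_nonneg _))
    (fun j => mul_le_mul_of_nonneg_right (hϰ.weight_le_one hε j) (sq_nonneg _))
    (Summable.mul_left (weight ϰ ε 1) ?_)
  simp_rw [normMean, div_pow]
  exact (summable_fourierCoeff_sq hφ S).div_const _

lemma summable_low_freq (hφ : Orthonormal ℝ φ) (S : L2) (K : ℝ) :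
    Summable fun j : ℕ+ => if (j : ℝ) < K then |fourierCoeff φ S j| ^ 2 else 0 := by
  refine Summable.of_nonneg_of_le (fun j => by split_ifs <;> positivity) (fun j => ?_)
    (summable_fourierCoeff_sq hφ S)
  split_ifs
  · rw [sq_abs]
  · positivity

lemma Conditions.le_energy (hϰ : Conditions ϰ) (hφ : Orthonormal ℝ φ) {ε : ℝ} (hε : 0 < ε)
    (S : L2) {K v : ℝ} (h : ∀ j : ℕ+, (j : ℝ) < K → v ≤ weight ϰ ε j) :
    v / ε ^ 2 * (∑' j : ℕ+, if (j : ℝ) < K then |fourierCoeff φ S j| ^ 2 else 0) ≤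
      energy φ ϰ ε S := by
  rw [energy, ← tsum_mul_left]
  refine Summable.tsum_le_tsum (fun j => ?_) ((summable_low_freq hφ S K).mul_left _)
    (hϰ.summable_energy hφ hε S)
  simp only [normMean]
  split_ifs with hj
  · rw [sq_abs, div_pow, div_mul_eq_mul_div, mul_div_assoc]
    exact mul_le_mul_of_nonneg_right (h j hj) (by positivity)
  · rw [mul_zero]
    exact mul_nonneg (weight_nonneg ϰ ε j) (sq_nonneg _)

/-- Frequencies below `K` use the uniform bound `v`; the others use `u` and Bessel's inequality. -/
lemma Conditions.energy_le (hϰ : Conditions ϰ) (hφ : Orthonormal ℝ φ) {ε : ℝ} (hε : 0 < ε)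
    (S : L2) {K v u : ℝ} (hv : ∀ j : ℕ+, weight ϰ ε j ≤ v) (hu : 0 ≤ u)
    (h : ∀ j : ℕ+, K ≤ (j : ℝ) → weight ϰ ε j ≤ u) :
    energy φ ϰ ε S ≤
      v / ε ^ 2 * (∑' j : ℕ+, if (j : ℝ) < K then |fourierCoeff φ S j| ^ 2 else 0) +
        u / ε ^ 2 * ‖S‖ ^ 2 := by
  have h1 : energy φ ϰ ε S ≤
      v / ε ^ 2 * (∑' j : ℕ+, if (j : ℝ) < K then |fourierCoeff φ S j| ^ 2 else 0) +
        u / ε ^ 2 * ∑' j, fourierCoeff φ S j ^ 2 := by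
    rw [energy, ← tsum_mul_left, ← tsum_mul_left, ← Summable.tsum_add
      ((summable_low_freq hφ S K).mul_left _) ((summable_fourierCoeff_sq hφ S).mul_left _)]
    refine Summable.tsum_le_tsum (fun j => ?_) (hϰ.summable_energy hφ hε S)
      (((summable_low_freq hφ S K).mul_left _).add
        ((summable_fourierCoeff_sq hφ S).mul_left _))
    have hθ : 0 ≤ fourierCoeff φ S j ^ 2 / ε ^ 2 := by positivity
    simp only [normMean, div_pow]
    split_ifs with hj
    · rw [sq_abs, div_mul_eq_mul_div, mul_div_assoc, div_mul_eq_mul_div, mul_div_assoc]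
      nlinarith [mul_le_mul_of_nonneg_right (hv j) hθ, mul_nonneg hu hθ]
    · rw [mul_zero, zero_add, div_mul_eq_mul_div, mul_div_assoc]
      exact mul_le_mul_of_nonneg_right (h j (not_lt.1 hj)) hθ
  have h2 := mul_le_mul_of_nonneg_left (tsum_fourierCoeff_sq_le hφ S)
    (show 0 ≤ u / ε ^ 2 by positivity)
  linarith

end

/-! ### Size of the weights -/

/-- The first `k` terms and the tail each contribute at most `D² k`, the latter by `∑_{i > k} i⁻² ≤
1/k`. -/
lemma tsum_sq_le_of_decay {f : ℕ+ → ℝ} (hf : ∀ j, 0 ≤ f j) {k : ℕ} (hk : k ≠ 0) {D : ℝ}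
    (h1 : ∀ j, f j ≤ D) (h2 : ∀ j : ℕ+, k < j → f j ≤ D * (k / j)) :
    ∑' j, f j ^ 2 ≤ 2 * D ^ 2 * k := by
  refine Real.tsum_le_of_sum_le (fun j => sq_nonneg _) fun s => ?_
  let g : ℕ → ℝ := fun i => if i ≤ k then D ^ 2 else D ^ 2 * k ^ 2 * ((i : ℝ) ^ 2)⁻¹
  have hg : ∀ i, 0 ≤ g i := fun i => by simp only [g]; split_ifs <;> positivity
  have hk0 : (0 : ℝ) < k := by exact_mod_cast Nat.pos_of_ne_zero hk
  let e : ℕ+ ↪ ℕ := ⟨fun j => (j : ℕ), PNat.coe_injective⟩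
  set n := max k ((s.map e).sup id)
  have hs : s.map e ⊆ Finset.Ioc 0 n := by
    intro i hi
    rw [Finset.mem_Ioc]
    refine ⟨?_, le_max_of_le_right (Finset.le_sup (f := id) hi)⟩
    obtain ⟨j, -, rfl⟩ := Finset.mem_map.1 hi
    exact j.pos
  calc ∑ j ∈ s, f j ^ 2 ≤ ∑ j ∈ s, g (e j) := by
        refine Finset.sum_le_sum fun j _ => ?_
        simp only [g, e, Function.Embedding.coeFn_mk]
        split_ifs with h
        · exact pow_le_pow_left₀ (hf j) (h1 j) 2
        · refine (pow_le_pow_left₀ (hf j) (h2 j (not_le.1 h)) 2).trans_eq ?_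
          rw [mul_pow, div_pow, div_eq_mul_inv, mul_assoc]
    _ = ∑ i ∈ s.map e, g i := (Finset.sum_map _ _ _).symm
    _ ≤ ∑ i ∈ Finset.Ioc 0 n, g i :=
        Finset.sum_le_sum_of_subset_of_nonneg hs fun i _ _ => hg i
    _ = ∑ i ∈ Finset.Ioc 0 k, g i + ∑ i ∈ Finset.Ioc k n, g i :=
        (Finset.sum_Ioc_consecutive g (Nat.zero_le _) (le_max_left _ _)).symm
    _ = D ^ 2 * k + D ^ 2 * k ^ 2 * ∑ i ∈ Finset.Ioc k n, ((i : ℝ) ^ 2)⁻¹ := by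
        congr 1
        · rw [Finset.sum_congr rfl (g := fun _ => D ^ 2)
            fun i hi => if_pos (Finset.mem_Ioc.1 hi).2]
          simp [mul_comm]
        · rw [Finset.mul_sum]
          exact Finset.sum_congr rfl fun i hi => if_neg (not_le.2 (Finset.mem_Ioc.1 hi).1)
    _ ≤ D ^ 2 * k + D ^ 2 * k ^ 2 * (k : ℝ)⁻¹ := by
        have := sum_Ioc_inv_sq_le_sub (α := ℝ) hk (le_max_left k ((s.map e).sup id))
        have h0 : (0 : ℝ) ≤ ((n : ℕ) : ℝ)⁻¹ := by positivity
        gcongr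
        linarith
    _ = 2 * D ^ 2 * k := by field_simp; ring

section

variable {ϰ : ℝ → ℕ+ → ℝ}

lemma Conditions.le_weight_of_lt (hϰ : Conditions ϰ) (c₂ : ℝ) :
    ∃ C > 0, ∀ ε > 0, 1 ≤ cutoff ϰ ε → ∀ j : ℕ+, (j : ℝ) < c₂ * cutoff ϰ ε →
      C * (kappaSq ϰ ε / ε ^ 2) ≤ weight ϰ ε j := by
  -- A4 needs a factor above 1, so `c₂` is raised to at least 2; monotonicity covers the smaller
  -- indices.
  obtain ⟨C, hC, h⟩ := hϰ.A4_tail (max c₂ 2) (lt_max_of_lt_right (by norm_num))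
  refine ⟨C, hC, fun ε hε hk j hj => ?_⟩
  have hk' : (1 : ℝ) ≤ cutoff ϰ ε := by exact_mod_cast hk
  have hle : (j : ℝ) ≤ max c₂ 2 * cutoff ϰ ε :=
    hj.le.trans (mul_le_mul_of_nonneg_right (le_max_left _ _) (by linarith))
  have hfl : (j : ℕ) ≤ ⌊max c₂ 2 * (cutoff ϰ ε : ℝ)⌋₊ := Nat.le_floor hle
  have hj' : j ≤ (⌊max c₂ 2 * (cutoff ϰ ε : ℝ)⌋₊).toPNat' := by
    rw [← PNat.coe_le_coe, Nat.toPNat'_coe, if_pos (j.pos.trans_le hfl)]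
    exact hfl
  rw [← mul_div_assoc]
  exact div_le_div_of_nonneg_right ((h ε hε).trans (hϰ.A1 ε hε hj')) (by positivity)

lemma Conditions.weight_le_of_ge (hϰ : Conditions ϰ) :
    ∃ C > 0, ∃ lam > (1 : ℝ), ∀ c > (1 : ℝ), ∀ ε > 0, 1 ≤ cutoff ϰ ε →
      ∀ j : ℕ+, c * cutoff ϰ ε ≤ j →
        weight ϰ ε j ≤ C * c ^ (-lam) * (kappaSq ϰ ε / ε ^ 2) := by
  obtain ⟨C, hC, lam, hl, h⟩ := hϰ.A3
  refine ⟨C, hC, lam, hl, fun c hc ε hε hk j hj => ?_⟩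
  have hk' : (1 : ℝ) ≤ cutoff ϰ ε := by exact_mod_cast hk
  have := h (c - 1) (by linarith) ε hε
  rw [add_sub_cancel] at this
  have hfl : ⌊c * (cutoff ϰ ε : ℝ)⌋₊ ≤ (j : ℕ) := Nat.floor_le_of_le hj
  have hpos : 0 < ⌊c * (cutoff ϰ ε : ℝ)⌋₊ := Nat.floor_pos.2 (by nlinarith)
  have hj' : (⌊c * (cutoff ϰ ε : ℝ)⌋₊).toPNat' ≤ j := by
    rw [← PNat.coe_le_coe, Nat.toPNat'_coe, if_pos hpos]
    exact hfl
  rw [← mul_div_assoc]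
  exact div_le_div_of_nonneg_right ((hϰ.A1 ε hε hj').trans this.le) (by positivity)

/-- By A1 each of the first `k_ε` weights is at least the one at `k_ε`, so this quantity is at most
`A_ε`. -/
lemma Conditions.cutoff_mul_sq_le (hϰ : Conditions ϰ) :
    ∃ C > 0, ∀ ε > 0, 1 ≤ cutoff ϰ ε →
      (cutoff ϰ ε : ℝ) * (kappaSq ϰ ε / ε ^ 2) ^ 2 ≤ C := by
  obtain ⟨C₁, h1, C₂, h2, h⟩ := hϰ.A2
  refine ⟨C₂, h2, fun ε hε hk => ?_⟩
  refine le_trans ?_ (h ε hε).2.le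
  rw [← tsum_weight_sq]
  set k := (cutoff ϰ ε).toPNat' with hkdef
  have hkk : (k : ℕ) = cutoff ϰ ε := by rw [hkdef, Nat.toPNat'_coe, if_pos (by omega)]
  refine le_trans ?_ ((hϰ.summable_weight_sq hε).sum_le_tsum (Finset.Icc 1 k)
    fun _ _ => sq_nonneg _)
  have := Finset.card_nsmul_le_sum (Finset.Icc 1 k) (fun j => weight ϰ ε j ^ 2)
    ((kappaSq ϰ ε / ε ^ 2) ^ 2) fun j hj =>
      pow_le_pow_left₀ (weight_nonneg ϰ ε k) (hϰ.weight_antitone hε (Finset.mem_Icc.1 hj).2) 2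
  rw [nsmul_eq_mul, PNat.card_Icc] at this
  simpa [hkk] using this

lemma Conditions.weight_one_le (hϰ : Conditions ϰ) :
    ∃ C > 0, ∀ᶠ ε in 𝓝[>] 0, weight ϰ ε 1 ≤ C * (kappaSq ϰ ε / ε ^ 2) := by
  obtain ⟨C, hC, h⟩ := hϰ.A4_first.1.exists_pos
  refine ⟨C, hC, ?_⟩
  filter_upwards [h.bound] with ε hε
  have h0 : 0 ≤ kappaSq ϰ ε := sq_nonneg _
  rw [Real.norm_of_nonneg (sq_nonneg _), Real.norm_of_nonneg h0] at hε
  rw [← mul_div_assoc]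
  exact div_le_div_of_nonneg_right hε (by positivity)

/-- The converse comparison: A4 bounds the weights up to `k_ε`, A3 those beyond, so `A_ε` is at most
a multiple of this quantity. -/
lemma Conditions.le_cutoff_mul_sq (hϰ : Conditions ϰ) :
    ∃ C > 0, ∀ᶠ ε in 𝓝[>] 0, 1 ≤ cutoff ϰ ε →
      C ≤ (cutoff ϰ ε : ℝ) * (kappaSq ϰ ε / ε ^ 2) ^ 2 := by
  obtain ⟨C₁, h1, C₂, h2, h⟩ := hϰ.A2
  obtain ⟨C, hC, hfirst⟩ := hϰ.weight_one_le
  obtain ⟨C', hC', lam, hl, hdecay⟩ := hϰ.weight_le_of_ge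
  refine ⟨C₁ / (2 * max C C' ^ 2), by positivity, ?_⟩
  filter_upwards [hfirst, self_mem_nhdsWithin] with ε hf hε hk
  have hε : 0 < ε := hε
  have hk0 : (0 : ℝ) < cutoff ϰ ε := by exact_mod_cast hk
  have hb0 : 0 ≤ kappaSq ϰ ε / ε ^ 2 := weight_nonneg ϰ ε _
  have := tsum_sq_le_of_decay (weight_nonneg ϰ ε) (k := cutoff ϰ ε) (by omega)
    (D := max C C' * (kappaSq ϰ ε / ε ^ 2)) ?_ ?_
  · rw [tsum_weight_sq] at this
    rw [div_le_iff₀ (by positivity)]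
    have := (h ε hε).1
    nlinarith
  · intro j
    refine (hϰ.weight_le_one hε j).trans (hf.trans ?_)
    exact mul_le_mul_of_nonneg_right (le_max_left _ _) hb0
  · intro j hj
    have hj' : (cutoff ϰ ε : ℝ) < j := by exact_mod_cast hj
    have hj0 : (0 : ℝ) < j := hk0.trans hj'
    have hc : 1 < (j : ℝ) / cutoff ϰ ε := (one_lt_div hk0).2 hj'
    refine (hdecay _ hc ε hε hk j (by field_simp; exact le_rfl)).trans ?_
    have hp : ((j : ℝ) / cutoff ϰ ε) ^ (-lam) ≤ cutoff ϰ ε / j := by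
      calc ((j : ℝ) / cutoff ϰ ε) ^ (-lam) ≤ ((j : ℝ) / cutoff ϰ ε) ^ (-1 : ℝ) :=
            Real.rpow_le_rpow_of_exponent_le hc.le (by linarith)
        _ = cutoff ϰ ε / j := by rw [Real.rpow_neg_one, inv_div]
    calc C' * ((j : ℝ) / cutoff ϰ ε) ^ (-lam) * (kappaSq ϰ ε / ε ^ 2)
        ≤ max C C' * (cutoff ϰ ε / j) * (kappaSq ϰ ε / ε ^ 2) := by
          gcongr
          exact le_max_right _ _
      _ = _ := by ring

end

end SignalDetection

end

noncomputable section

namespace SignalDetection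

/-! ### Consistency in terms of the energy -/

section

variable {Ω : Type*} [MeasurableSpace Ω] {P : Measure Ω} [IsProbabilityMeasure P]
  {W : L2 → Ω → ℝ} {φ : ℕ+ → L2} {ϰ : ℝ → ℕ+ → ℝ} {R : ℝ → ℝ} {S : ℝ → L2}

lemma typeI_le (hW : IsWhiteNoise P W) (hφ : Orthonormal ℝ φ) (hϰ : Conditions ϰ) {ε : ℝ}
    (hε : 0 < ε) {s : ℝ} (hs0 : 0 ≤ s) (hs : ∀ j, s * weight ϰ ε j ≤ 1 / 4) (t : ℝ) :
    typeI P W φ ϰ ε (t * ε ^ 2 / √(normA ϰ ε)) ≤ Real.exp (-s * t + 4 * s ^ 2 * normA ϰ ε) := by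
  rw [typeI_eq hε (hϰ.normA_pos hε)]
  have := measureReal_tsum_weighted_sq_gt_le (hW.iIndepFun hφ) (fun j => hW.hasLaw (hφ.1 j))
    (weight_nonneg ϰ ε) (m := 0) (hϰ.summable_weight hε) (hϰ.summable_weight_sq hε) (by simp)
    hs0 hs (∑' j, weight ϰ ε j + t)
  simp only [Pi.zero_apply, add_zero, tsum_weight_sq] at this
  refine this.trans_eq ?_
  congr 1
  simp
  ring

lemma le_typeI (hW : IsWhiteNoise P W) (hφ : Orthonormal ℝ φ) (hϰ : Conditions ϰ) {ε : ℝ}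
    (hε : 0 < ε) {s : ℝ} (hs0 : 0 ≤ s) (hs : ∀ j, s * weight ϰ ε j ≤ 1 / 8) {t : ℝ}
    (ht : s * t + Real.log 2 < s ^ 2 * normA ϰ ε) :
    1 / 4 * Real.exp (-14 * s ^ 2 * normA ϰ ε) ≤
      typeI P W φ ϰ ε (t * ε ^ 2 / √(normA ϰ ε)) := by
  rw [typeI_eq hε (hϰ.normA_pos hε)]
  rw [← tsum_weight_sq] at ht ⊢
  exact le_measureReal_tsum_weighted_sq_gt (hW.iIndepFun hφ) (fun j => hW.hasLaw (hφ.1 j))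
    (weight_nonneg ϰ ε) (hϰ.summable_weight hε) (hϰ.summable_weight_sq hε) hs0 hs ht

lemma typeII_le (hW : IsWhiteNoise P W) (hφ : Orthonormal ℝ φ) (hϰ : Conditions ϰ) {ε : ℝ}
    (hε : 0 < ε) {s : ℝ} (hs0 : 0 ≤ s) (hs : ∀ j, s * weight ϰ ε j ≤ 1 / 4) (t : ℝ) (S : L2) :
    typeII P W φ ϰ ε (t * ε ^ 2 / √(normA ϰ ε)) S ≤
      Real.exp (s * t + s ^ 2 * normA ϰ ε - s / 2 * energy φ ϰ ε S) := by
  rw [typeII_eq hε (hϰ.normA_pos hε)]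
  have := measureReal_tsum_weighted_sq_le_le (hW.iIndepFun hφ) (fun j => hW.hasLaw (hφ.1 j))
    (weight_nonneg ϰ ε) (hϰ.summable_weight hε) (hϰ.summable_weight_sq hε)
    (hϰ.summable_energy hφ hε S) hs0 hs (∑' j, weight ϰ ε j + t)
  rw [tsum_weight_sq] at this
  refine this.trans_eq ?_
  rw [energy]
  congr 1
  ring

lemma one_sub_le_typeII (hW : IsWhiteNoise P W) (hφ : Orthonormal ℝ φ) (hϰ : Conditions ϰ)
    {ε : ℝ} (hε : 0 < ε) {s : ℝ} (hs0 : 0 ≤ s) (hs : ∀ j, s * weight ϰ ε j ≤ 1 / 4) (t : ℝ)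
    (S : L2) :
    1 - Real.exp (-s * t + 4 * s ^ 2 * normA ϰ ε + 2 * s * energy φ ϰ ε S) ≤
      typeII P W φ ϰ ε (t * ε ^ 2 / √(normA ϰ ε)) S := by
  rw [typeII_eq hε (hϰ.normA_pos hε)]
  have := measureReal_tsum_weighted_sq_gt_le (hW.iIndepFun hφ) (fun j => hW.hasLaw (hφ.1 j))
    (weight_nonneg ϰ ε) (hϰ.summable_weight hε) (hϰ.summable_weight_sq hε)
    (hϰ.summable_energy hφ hε S) hs0 hs (∑' j, weight ϰ ε j + t)
  rw [tsum_weight_sq] at this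
  set E := {ω | ∑' j, weight ϰ ε j * (W (φ j) ω + normMean φ ε S j) ^ 2 ≤
        ∑' j, weight ϰ ε j + t} with hE
  have hEc : {ω | ∑' j, weight ϰ ε j + t <
      ∑' j, weight ϰ ε j * (W (φ j) ω + normMean φ ε S j) ^ 2} = Eᶜ := by
    ext ω; simp [hE]
  rw [hEc] at this
  have h1 : 1 ≤ P.real E + P.real Eᶜ := by
    have := measureReal_union_le (μ := P) E Eᶜ
    rwa [Set.union_compl_self, probReal_univ] at this
  have h2 : -s * (∑' j, weight ϰ ε j + t) + (s * ∑' j, weight ϰ ε j + 4 * s ^ 2 * normA ϰ ε +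
      2 * s * ∑' j, weight ϰ ε j * normMean φ ε S j ^ 2) =
      -s * t + 4 * s ^ 2 * normA ϰ ε + 2 * s * energy φ ϰ ε S := by
    rw [energy]; ring
  rw [h2] at this
  linarith

lemma eventually_mul_weight_le (hRw : ∀ η > 0, ∀ᶠ ε in 𝓝[>] 0, ∀ j, R ε * weight ϰ ε j ≤ η)
    {σ η : ℝ} (hσ : 0 < σ) (hη : 0 < η) :
    ∀ᶠ ε in 𝓝[>] 0, ∀ j, σ * R ε * weight ϰ ε j ≤ η := by
  filter_upwards [hRw (η / σ) (by positivity)] with ε h j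
  have := mul_le_mul_of_nonneg_left (h j) hσ.le
  rw [mul_div_cancel₀ _ hσ.ne'] at this
  linarith

/-- Critical values with `log α = o(R²)` are, after normalisation, asymptotically smaller than any
multiple of `R`. -/
lemma eventually_critical_le (hW : IsWhiteNoise P W) (hφ : Orthonormal ℝ φ) (hϰ : Conditions ϰ)
    (hR : Tendsto R (𝓝[>] 0) atTop)
    (hRw : ∀ η > 0, ∀ᶠ ε in 𝓝[>] 0, ∀ j, R ε * weight ϰ ε j ≤ η) {t : ℝ → ℝ}
    (hpos : ∀ᶠ ε in 𝓝[>] 0, 0 < typeI P W φ ϰ ε (t ε * ε ^ 2 / √(normA ϰ ε)))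
    (hlim : Tendsto (fun ε => (R ε ^ 2)⁻¹ *
      Real.log (typeI P W φ ϰ ε (t ε * ε ^ 2 / √(normA ϰ ε)))) (𝓝[>] 0) (𝓝 0))
    {δ : ℝ} (hδ : 0 < δ) : ∀ᶠ ε in 𝓝[>] 0, t ε ≤ δ * R ε := by
  obtain ⟨C₁, h1, C₂, h2, hA⟩ := hϰ.A2
  -- Minimises `-ηδ + 4η²C₂`, with minimum `-δ²/(16 C₂)`.
  set η := δ / (8 * C₂) with hη
  have hη0 : 0 < η := by positivity
  filter_upwards [hpos, hlim.eventually (lt_mem_nhds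
      (show -(δ ^ 2 / (16 * C₂)) < 0 by rw [neg_lt_zero]; positivity)),
    eventually_mul_weight_le hRw hη0 (show (0 : ℝ) < 1 / 4 by norm_num),
    hR.eventually_gt_atTop 0, self_mem_nhdsWithin] with ε hp hl hw hR0 hε
  have hε : 0 < ε := hε
  by_contra! hcon
  have hle := typeI_le hW hφ hϰ hε (mul_nonneg hη0.le hR0.le) hw (t ε)
  have hlog := (Real.log_le_log hp hle).trans_eq (Real.log_exp _)
  have hbd : -(η * R ε) * t ε + 4 * (η * R ε) ^ 2 * normA ϰ ε ≤
      -(δ ^ 2 / (16 * C₂)) * R ε ^ 2 := by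
    have e1 : η * R ε * (δ * R ε) ≤ η * R ε * t ε :=
      mul_le_mul_of_nonneg_left hcon.le (by positivity)
    have e2 : 4 * (η * R ε) ^ 2 * normA ϰ ε ≤ 4 * (η * R ε) ^ 2 * C₂ :=
      mul_le_mul_of_nonneg_left (hA ε hε).2.le (by positivity)
    have e3 : -(η * R ε * (δ * R ε)) + 4 * (η * R ε) ^ 2 * C₂ =
        -(δ ^ 2 / (16 * C₂)) * R ε ^ 2 := by rw [hη]; field_simp; ring
    linarith
  have hfin := mul_le_mul_of_nonneg_left (hlog.trans hbd)
    (show 0 ≤ (R ε ^ 2)⁻¹ by positivity)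
  have e4 : (R ε ^ 2)⁻¹ * (-(δ ^ 2 / (16 * C₂)) * R ε ^ 2) = -(δ ^ 2 / (16 * C₂)) := by
    field_simp
  linarith

lemma isLDConsistent_of_energy (hW : IsWhiteNoise P W) (hφ : Orthonormal ℝ φ)
    (hϰ : Conditions ϰ) (hR : Tendsto R (𝓝[>] 0) atTop)
    (hRw : ∀ η > 0, ∀ᶠ ε in 𝓝[>] 0, ∀ j, R ε * weight ϰ ε j ≤ η)
    (hen : ∃ c > 0, ∀ᶠ ε in 𝓝[>] 0, c * R ε ≤ energy φ ϰ ε (S ε)) :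
    IsLDConsistent P W φ ϰ R S := by
  intro x hpos hlim
  obtain ⟨c, hc, hen⟩ := hen
  obtain ⟨C₁, h1, C₂, h2, hA⟩ := hϰ.A2
  let t : ℝ → ℝ := fun ε => x ε * √(normA ϰ ε) / ε ^ 2
  have hx : ∀ ε > 0, t ε * ε ^ 2 / √(normA ϰ ε) = x ε := by
    intro ε hε
    have : 0 < √(normA ϰ ε) := Real.sqrt_pos.2 (hϰ.normA_pos hε)
    simp only [t]
    field_simp
  have hpos' : ∀ᶠ ε in 𝓝[>] 0, 0 < typeI P W φ ϰ ε (t ε * ε ^ 2 / √(normA ϰ ε)) := by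
    filter_upwards [hpos, self_mem_nhdsWithin] with ε h hε
    rwa [hx ε hε]
  have hlim' : Tendsto (fun ε => (R ε ^ 2)⁻¹ *
      Real.log (typeI P W φ ϰ ε (t ε * ε ^ 2 / √(normA ϰ ε)))) (𝓝[>] 0) (𝓝 0) := by
    refine hlim.congr' ?_
    filter_upwards [self_mem_nhdsWithin] with ε hε
    rw [hx ε hε]
  -- With `s = ηR`, the threshold and the variance term each cost `ηcR²/8`, against a gain of
  -- `ηcR²/2` from the energy.
  set η := c / (8 * C₂) with hη
  have hη0 : 0 < η := by positivity
  refine ⟨η * c / 4, by positivity, ?_⟩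
  filter_upwards [hen, eventually_critical_le hW hφ hϰ hR hRw hpos' hlim'
      (show 0 < c / 8 by positivity),
    eventually_mul_weight_le hRw hη0 (show (0 : ℝ) < 1 / 4 by norm_num),
    hR.eventually_gt_atTop 0, self_mem_nhdsWithin] with ε he ht hw hR0 hε
  have hε : 0 < ε := hε
  rw [or_iff_not_imp_left]
  intro hβ
  have hle := typeII_le hW hφ hϰ hε (mul_nonneg hη0.le hR0.le) hw (t ε) (S ε)
  rw [hx ε hε] at hle
  have hβ0 : 0 < typeII P W φ ϰ ε (x ε) (S ε) := lt_of_le_of_ne measureReal_nonneg (Ne.symm hβ)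
  have hlog := (Real.log_le_log hβ0 hle).trans_eq (Real.log_exp _)
  refine le_trans ?_ (neg_le_abs _)
  have e1 : η * R ε * t ε ≤ η * R ε * (c / 8 * R ε) :=
    mul_le_mul_of_nonneg_left ht (by positivity)
  have e2 : (η * R ε) ^ 2 * normA ϰ ε ≤ (η * R ε) ^ 2 * C₂ :=
    mul_le_mul_of_nonneg_left (hA ε hε).2.le (by positivity)
  have e3 : η * R ε / 2 * (c * R ε) ≤ η * R ε / 2 * energy φ ϰ ε (S ε) :=
    mul_le_mul_of_nonneg_left he (by positivity)
  have e4 : η * R ε * (c / 8 * R ε) + (η * R ε) ^ 2 * C₂ - η * R ε / 2 * (c * R ε) =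
      -(η * c / 4 * R ε ^ 2) := by rw [hη]; field_simp; ring
  linarith

/-- Normalised critical values of order `o(R)` have `log α = o(R²)`. -/
lemma tendsto_log_typeI (hW : IsWhiteNoise P W) (hφ : Orthonormal ℝ φ)
    (hϰ : Conditions ϰ) (hR : Tendsto R (𝓝[>] 0) atTop)
    (hRw : ∀ η > 0, ∀ᶠ ε in 𝓝[>] 0, ∀ j, R ε * weight ϰ ε j ≤ η) {t : ℝ → ℝ}
    (ht : ∀ δ > 0, ∀ᶠ ε in 𝓝[>] 0, t ε ≤ δ * R ε) :
    (∀ᶠ ε in 𝓝[>] 0, 0 < typeI P W φ ϰ ε (t ε * ε ^ 2 / √(normA ϰ ε))) ∧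
    Tendsto (fun ε => (R ε ^ 2)⁻¹ *
      Real.log (typeI P W φ ϰ ε (t ε * ε ^ 2 / √(normA ϰ ε)))) (𝓝[>] 0) (𝓝 0) := by
  obtain ⟨C₁, h1, C₂, h2, hA⟩ := hϰ.A2
  have hR2 : Tendsto (fun ε => R ε ^ 2) (𝓝[>] 0) atTop :=
    (tendsto_pow_atTop two_ne_zero).comp hR
  have hlow : ∀ σ > 0, ∀ᶠ ε in 𝓝[>] 0, 1 / 4 * Real.exp (-14 * σ ^ 2 * C₂ * R ε ^ 2) ≤
      typeI P W φ ϰ ε (t ε * ε ^ 2 / √(normA ϰ ε)) := by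
    intro σ hσ
    filter_upwards [ht (σ * C₁ / 2) (by positivity),
      eventually_mul_weight_le hRw hσ (show (0 : ℝ) < 1 / 8 by norm_num),
      hR.eventually_gt_atTop 0, hR2.eventually_gt_atTop (Real.log 2 / (σ ^ 2 * C₁ / 2)),
      self_mem_nhdsWithin] with ε ht hw hR0 hRl hε
    have hε : 0 < ε := hε
    have hlog : Real.log 2 < R ε ^ 2 * (σ ^ 2 * C₁ / 2) := (div_lt_iff₀ (by positivity)).1 hRl
    refine le_trans ?_ (le_typeI hW hφ hϰ hε (mul_nonneg hσ.le hR0.le) hw ?_)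
    · have : (σ * R ε) ^ 2 * normA ϰ ε ≤ (σ * R ε) ^ 2 * C₂ :=
        mul_le_mul_of_nonneg_left (hA ε hε).2.le (by positivity)
      refine mul_le_mul_of_nonneg_left (Real.exp_le_exp.2 ?_) (by norm_num)
      nlinarith
    · have e1 : σ * R ε * t ε ≤ σ * R ε * (σ * C₁ / 2 * R ε) :=
        mul_le_mul_of_nonneg_left ht (by positivity)
      have e2 : (σ * R ε) ^ 2 * C₁ ≤ (σ * R ε) ^ 2 * normA ϰ ε :=
        mul_le_mul_of_nonneg_left (hA ε hε).1.le (by positivity)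
      nlinarith
  have hpos : ∀ᶠ ε in 𝓝[>] 0, 0 < typeI P W φ ϰ ε (t ε * ε ^ 2 / √(normA ϰ ε)) := by
    filter_upwards [hlow 1 one_pos] with ε h
    exact lt_of_lt_of_le (by positivity) h
  refine ⟨hpos, Metric.tendsto_nhds.2 fun δ hδ => ?_⟩
  -- The exponent costs `14σ²C₂` and `log 4` less than another `σ²C₂`, after division by `R²`; the
  -- total stays below `δ`.
  set σ := √(δ / (16 * C₂)) with hσ
  have hσ0 : 0 < σ := Real.sqrt_pos.2 (by positivity)
  have hσ2 : 16 * σ ^ 2 * C₂ = δ := by rw [hσ, Real.sq_sqrt (by positivity)]; field_simp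
  filter_upwards [hpos, hlow σ hσ0, hR.eventually_gt_atTop 0,
    hR2.eventually_gt_atTop (Real.log 4 / (σ ^ 2 * C₂))] with ε hp hl hR0 hRl
  have hlog4 : Real.log 4 < R ε ^ 2 * (σ ^ 2 * C₂) := (div_lt_iff₀ (by positivity)).1 hRl
  have hle1 : Real.log (typeI P W φ ϰ ε (t ε * ε ^ 2 / √(normA ϰ ε))) ≤ 0 :=
    Real.log_nonpos measureReal_nonneg measureReal_le_one
  have hge := Real.log_le_log (by positivity) hl
  rw [Real.log_mul (by norm_num) (Real.exp_pos _).ne', Real.log_exp, one_div, Real.log_inv] at hge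
  rw [Real.dist_eq, sub_zero, abs_mul, abs_of_nonpos hle1, abs_of_nonneg (by positivity),
    inv_mul_lt_iff₀ (by positivity), ← hσ2]
  have : 0 < σ ^ 2 * C₂ * R ε ^ 2 := by positivity
  nlinarith

lemma energy_of_isLDConsistent (hW : IsWhiteNoise P W) (hφ : Orthonormal ℝ φ)
    (hϰ : Conditions ϰ) (hR : Tendsto R (𝓝[>] 0) atTop)
    (hRw : ∀ η > 0, ∀ᶠ ε in 𝓝[>] 0, ∀ j, R ε * weight ϰ ε j ≤ η)
    (hLD : IsLDConsistent P W φ ϰ R S) :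
    ∃ c > 0, ∀ᶠ ε in 𝓝[>] 0, c * R ε ≤ energy φ ϰ ε (S ε) := by
  by_contra! hcon
  obtain ⟨C₁, h1, C₂, h2, hA⟩ := hϰ.A2
  have hex : ∀ n : ℕ, ∃ ε : ℝ, 0 < ε ∧ ε < 1 / ((n : ℝ) + 1) ∧
      energy φ ϰ ε (S ε) < 1 / ((n : ℝ) + 1) * R ε := by
    intro n
    have hn : (0 : ℝ) < 1 / ((n : ℝ) + 1) := by positivity
    obtain ⟨ε, h, hε⟩ := ((hcon _ hn).and_eventually (Ioo_mem_nhdsGT hn)).exists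
    exact ⟨ε, hε.1, hε.2, h⟩
  choose u hu0 hu1 hu2 using hex
  have hu : Tendsto u atTop (𝓝[>] 0) :=
    tendsto_nhdsWithin_iff.2 ⟨squeeze_zero (fun n => (hu0 n).le) (fun n => (hu1 n).le)
      tendsto_one_div_add_atTop_nhds_zero_nat, Eventually.of_forall hu0⟩
  classical
  -- On the bad sequence the threshold makes the Chernoff exponent at `s = 1`, namely `-t + 4A_ε +
  -- 2E`, at most `-1`. Elsewhere any `o(R)` value serves.
  let t : ℝ → ℝ := fun ε =>
    if ε ∈ Set.range u then 2 * energy φ ϰ ε (S ε) + (4 * C₂ + 1) else 0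
  have ht : ∀ δ > 0, ∀ᶠ ε in 𝓝[>] 0, t ε ≤ δ * R ε := by
    intro δ hδ
    obtain ⟨N, hN⟩ := exists_nat_one_div_lt (show 0 < δ / 4 by positivity)
    -- Below the first `N` terms, any `ε` in the range of `u` can only be some `u n` with `n ≥ N`.
    have hNu : ∀ᶠ ε in 𝓝[>] 0, ∀ i ∈ Finset.range N, ε < u i :=
      (eventually_all_finset _).2 fun i _ => nhdsWithin_le_nhds (gt_mem_nhds (hu0 i))
    filter_upwards [hNu, hR.eventually_gt_atTop 0,
      hR.eventually_gt_atTop ((4 * C₂ + 1) / (δ / 2))] with ε hε hR0 hRl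
    have hK : 4 * C₂ + 1 < R ε * (δ / 2) := (div_lt_iff₀ (by positivity)).1 hRl
    simp only [t]
    split_ifs with hr
    · obtain ⟨n, rfl⟩ := hr
      have hn : N ≤ n := by
        by_contra! h
        exact lt_irrefl _ (hε n (Finset.mem_range.2 h))
      have hn' : 1 / ((n : ℝ) + 1) ≤ 1 / ((N : ℝ) + 1) := by
        apply one_div_le_one_div_of_le (by positivity)
        have : (N : ℝ) ≤ n := by exact_mod_cast hn
        linarith
      have e1 : 1 / ((n : ℝ) + 1) * R (u n) ≤ δ / 4 * R (u n) :=
        mul_le_mul_of_nonneg_right (hn'.trans hN.le) hR0.le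
      have := hu2 n
      linarith
    · positivity
  obtain ⟨hp, hl⟩ := tendsto_log_typeI hW hφ hϰ hR hRw ht
  obtain ⟨c, hc, hfin⟩ := hLD _ hp hl
  have hR2 : Tendsto (fun ε => R ε ^ 2) (𝓝[>] 0) atTop :=
    (tendsto_pow_atTop two_ne_zero).comp hR
  obtain ⟨n, hn, hw, hR1, hRl⟩ := (hu.eventually (hfin.and
    ((hRw (1 / 4) (by norm_num)).and ((hR.eventually_ge_atTop 1).and
      (hR2.eventually_gt_atTop (Real.log 2 / c)))))).exists
  have hw' : ∀ j, 1 * weight ϰ (u n) j ≤ 1 / 4 := fun j =>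
    (mul_le_mul_of_nonneg_right hR1 (weight_nonneg ϰ _ j)).trans (hw j)
  have hge := one_sub_le_typeII hW hφ hϰ (hu0 n) zero_le_one hw' (t (u n)) (S (u n))
  have htn : t (u n) = 2 * energy φ ϰ (u n) (S (u n)) + (4 * C₂ + 1) :=
    if_pos ⟨n, rfl⟩
  have hexp : Real.exp (-1 * t (u n) + 4 * 1 ^ 2 * normA ϰ (u n) +
      2 * 1 * energy φ ϰ (u n) (S (u n))) ≤ 1 / 2 := by
    have h4 : -1 * t (u n) + 4 * 1 ^ 2 * normA ϰ (u n) +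
      2 * 1 * energy φ ϰ (u n) (S (u n)) ≤ -1 := by
      have := (hA (u n) (hu0 n)).2
      rw [htn]
      linarith
    refine (Real.exp_le_exp.2 h4).trans ?_
    rw [Real.exp_neg, one_div]
    exact inv_anti₀ two_pos (by linarith [Real.add_one_le_exp 1])
  set β := typeII P W φ ϰ (u n) (t (u n) * u n ^ 2 / √(normA ϰ (u n))) (S (u n))
  have hβ : 1 / 2 ≤ β :=
    (by norm_num : (1 / 2 : ℝ) ≤ 1 - 1 / 2).trans ((sub_le_sub_left hexp 1).trans hge)
  rcases hn with h0 | h0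
  · linarith
  · have hβ1 : Real.log β ≤ 0 := Real.log_nonpos (by linarith) measureReal_le_one
    have hβ2 := Real.log_le_log (by norm_num) hβ
    rw [one_div, Real.log_inv] at hβ2
    rw [abs_of_nonpos hβ1] at h0
    have := (div_lt_iff₀ hc).1 hRl
    nlinarith

end

/-! ### The energy in terms of the Fourier coefficients -/

section

variable {φ : ℕ+ → L2} {ϰ : ℝ → ℕ+ → ℝ} {r w : ℝ} {S : ℝ → L2}

/-- Excludes the value 0, which `toPNat'` would silently turn into 1; the lower growth bound
suffices. -/
lemma eventually_one_le_cutoff {q : ℝ}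
    (hk : (fun ε => (cutoff ϰ ε : ℝ)) =Θ[𝓝[>] 0] fun ε : ℝ => ε ^ q) :
    ∀ᶠ ε in 𝓝[>] 0, 1 ≤ cutoff ϰ ε := by
  obtain ⟨C, hC, h⟩ := hk.2.exists_pos
  filter_upwards [h.bound, self_mem_nhdsWithin] with ε h hε
  have hε : 0 < ε := hε
  have := Real.rpow_pos_of_pos hε q
  rw [Real.norm_of_nonneg this.le] at h
  by_contra! hlt
  rw [Nat.lt_one_iff] at hlt
  rw [hlt] at h
  simp at h
  linarith

lemma exists_kappaSq_le (hϰ : Conditions ϰ) {p : ℝ}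
    (hk : (fun ε => (cutoff ϰ ε : ℝ)) =Θ[𝓝[>] 0] fun ε : ℝ => ε ^ (-(p * 2))) :
    ∃ C > 0, ∀ᶠ ε in 𝓝[>] 0, kappaSq ϰ ε / ε ^ 2 ≤ C * ε ^ p := by
  obtain ⟨C, hC, h⟩ := hk.2.exists_pos
  obtain ⟨C', hC', h'⟩ := hϰ.cutoff_mul_sq_le
  refine ⟨√(C' * C), by positivity, ?_⟩
  filter_upwards [h.bound, eventually_one_le_cutoff hk, self_mem_nhdsWithin] with ε h hk1 hε
  have hε : 0 < ε := hε
  have hpos := Real.rpow_pos_of_pos hε p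
  rw [Real.norm_of_nonneg (Real.rpow_nonneg hε.le _), Real.norm_of_nonneg (Nat.cast_nonneg _),
    Real.rpow_neg hε.le, Real.rpow_mul hε.le, Real.rpow_two] at h
  have h2 := h' ε hε hk1
  refine abs_le_of_sq_le_sq' ?_ (by positivity) |>.2
  rw [mul_pow, Real.sq_sqrt (by positivity)]
  set v := kappaSq ϰ ε / ε ^ 2
  have h3 := mul_le_mul_of_nonneg_right h (sq_nonneg v)
  have h4 : v ^ 2 = (ε ^ p) ^ 2 * (((ε ^ p) ^ 2)⁻¹ * v ^ 2) := by field_simp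
  rw [h4, mul_comm]
  refine mul_le_mul_of_nonneg_right (h3.trans ?_) (sq_nonneg _)
  nlinarith

lemma exists_le_kappaSq (hϰ : Conditions ϰ) {p : ℝ}
    (hk : (fun ε => (cutoff ϰ ε : ℝ)) =Θ[𝓝[>] 0] fun ε : ℝ => ε ^ (-(p * 2))) :
    ∃ C > 0, ∀ᶠ ε in 𝓝[>] 0, C * ε ^ p ≤ kappaSq ϰ ε / ε ^ 2 := by
  obtain ⟨C, hC, h⟩ := hk.1.exists_pos
  obtain ⟨C', hC', h'⟩ := hϰ.le_cutoff_mul_sq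
  refine ⟨√(C' / C), by positivity, ?_⟩
  filter_upwards [h.bound, h', eventually_one_le_cutoff hk, self_mem_nhdsWithin]
    with ε h h' hk1 hε
  have hε : 0 < ε := hε
  have hpos := Real.rpow_pos_of_pos hε p
  rw [Real.norm_of_nonneg (Real.rpow_nonneg hε.le _), Real.norm_of_nonneg (Nat.cast_nonneg _),
    Real.rpow_neg hε.le, Real.rpow_mul hε.le, Real.rpow_two] at h
  have h2 := h' hk1
  have hv : 0 ≤ kappaSq ϰ ε / ε ^ 2 := weight_nonneg ϰ ε _
  refine abs_le_of_sq_le_sq' ?_ hv |>.2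
  rw [mul_pow, Real.sq_sqrt (by positivity)]
  set v := kappaSq ϰ ε / ε ^ 2
  have h3 := h2.trans (mul_le_mul_of_nonneg_right h (sq_nonneg v))
  rw [div_mul_eq_mul_div, div_le_iff₀ hC]
  have h4 := mul_le_mul_of_nonneg_right h3 (sq_nonneg (ε ^ p))
  have h5 : C * ((ε ^ p) ^ 2)⁻¹ * v ^ 2 * (ε ^ p) ^ 2 = v ^ 2 * C := by field_simp
  linarith

lemma exists_weight_le (hϰ : Conditions ϰ) {p : ℝ}
    (hk : (fun ε => (cutoff ϰ ε : ℝ)) =Θ[𝓝[>] 0] fun ε : ℝ => ε ^ (-(p * 2))) :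
    ∃ C > 0, ∀ᶠ ε in 𝓝[>] 0, ∀ j, weight ϰ ε j ≤ C * ε ^ p := by
  obtain ⟨C, hC, h⟩ := hϰ.weight_one_le
  obtain ⟨C', hC', h'⟩ := exists_kappaSq_le hϰ hk
  refine ⟨C * C', by positivity, ?_⟩
  filter_upwards [h, h', self_mem_nhdsWithin] with ε h h' hε j
  refine (hϰ.weight_le_one hε j).trans (h.trans ?_)
  rw [mul_assoc]
  exact mul_le_mul_of_nonneg_left h' hC.le

lemma eventually_rpow_mul_weight_le (hϰ : Conditions ϰ) {p a : ℝ} (ha : 0 < a + p)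
    (hk : (fun ε => (cutoff ϰ ε : ℝ)) =Θ[𝓝[>] 0] fun ε : ℝ => ε ^ (-(p * 2))) :
    ∀ η > 0, ∀ᶠ ε in 𝓝[>] 0, ∀ j, ε ^ a * weight ϰ ε j ≤ η := by
  intro η hη
  obtain ⟨C, hC, h⟩ := exists_weight_le hϰ hk
  have hlim : Tendsto (fun ε : ℝ => C * ε ^ (a + p)) (𝓝[>] 0) (𝓝 0) := by
    have := ((Real.continuousAt_rpow_const 0 (a + p) (Or.inr ha.le)).tendsto.const_mul C)
    rw [Real.zero_rpow ha.ne', mul_zero] at this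
    exact this.mono_left nhdsWithin_le_nhds
  filter_upwards [h, hlim.eventually (gt_mem_nhds hη), self_mem_nhdsWithin] with ε h hl hε j
  have hε : 0 < ε := hε
  calc ε ^ a * weight ϰ ε j ≤ ε ^ a * (C * ε ^ p) :=
        mul_le_mul_of_nonneg_left (h j) (Real.rpow_nonneg hε.le _)
    _ = C * ε ^ (a + p) := by rw [Real.rpow_add hε]; ring
    _ ≤ η := hl.le

/-- The exponent balance: typical weight times squared signal norm over `ε²` is exactly `R`. -/
lemma rpow_scaling {ε : ℝ} (hε : 0 < ε) (r w : ℝ) :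
    ε ^ (2 - 4 * r - 2 * w) / ε ^ 2 * ε ^ (4 * r) = ε ^ (-2 * w) := by
  rw [← Real.rpow_two, ← Real.rpow_sub hε, ← Real.rpow_add hε]
  congr 1
  ring

lemma exists_norm_sq_le (hS : (fun ε => ‖S ε‖) =Θ[𝓝[>] 0] fun ε : ℝ => ε ^ (2 * r)) :
    ∃ C > 0, ∀ᶠ ε in 𝓝[>] 0, ‖S ε‖ ^ 2 ≤ C * ε ^ (4 * r) := by
  obtain ⟨C, hC, h⟩ := hS.1.exists_pos
  refine ⟨C ^ 2, by positivity, ?_⟩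
  filter_upwards [h.bound, self_mem_nhdsWithin] with ε h hε
  have hε : 0 < ε := hε
  rw [norm_norm, Real.norm_of_nonneg (Real.rpow_nonneg hε.le _)] at h
  refine (pow_le_pow_left₀ (norm_nonneg _) h 2).trans_eq ?_
  rw [mul_pow, ← Real.rpow_mul_natCast hε.le]
  congr 2
  push_cast
  ring

lemma energy_lower_iff (hφ : Orthonormal ℝ φ) (hϰ : Conditions ϰ)
    (hk : (fun ε => (cutoff ϰ ε : ℝ)) =Θ[𝓝[>] 0]
      fun ε : ℝ => ε ^ (-((2 - 4 * r - 2 * w) * 2)))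
    (hS : (fun ε => ‖S ε‖) =Θ[𝓝[>] 0] fun ε : ℝ => ε ^ (2 * r)) :
    (∃ c > 0, ∀ᶠ ε in 𝓝[>] 0, c * ε ^ (-2 * w) ≤ energy φ ϰ ε (S ε)) ↔
      ∃ c₁ > (0 : ℝ), ∃ c₂ > (0 : ℝ), ∃ ε₀ > (0 : ℝ), ∀ ε : ℝ, 0 < ε → ε < ε₀ →
        c₁ * ε ^ (4 * r) <
          ∑' j : ℕ+, if (j : ℝ) < c₂ * cutoff ϰ ε then |fourierCoeff φ (S ε) j| ^ 2 else 0 := by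
  constructor
  · rintro ⟨c, hc, hen⟩
    obtain ⟨Cw, hCw, hw⟩ := exists_weight_le hϰ hk
    obtain ⟨Ck, hCk, hkap⟩ := exists_kappaSq_le hϰ hk
    obtain ⟨C, hC, lam, hl, hdec⟩ := hϰ.weight_le_of_ge
    obtain ⟨Cs, hCs, hs⟩ := exists_norm_sq_le hS
    -- Large enough that the frequencies beyond `c₂ k_ε` carry at most half of the energy `c R`; of
    -- A3 only decay of order `c₂⁻¹` is needed.
    set c₂ := max 2 (2 * (C * Ck * Cs) / c) with hc₂
    have hc₂1 : 1 < c₂ := lt_max_of_lt_left (by norm_num)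
    have hc₂0 : 0 < c₂ := by linarith
    have hpow : C * c₂ ^ (-lam) * Ck * Cs ≤ c / 2 := by
      have h1 : c₂ ^ (-lam) ≤ c₂⁻¹ := by
        rw [← Real.rpow_neg_one]
        exact Real.rpow_le_rpow_of_exponent_le hc₂1.le (by linarith)
      have h2 : 2 * (C * Ck * Cs) ≤ c₂ * c := (div_le_iff₀ hc).1 (le_max_right _ _)
      calc C * c₂ ^ (-lam) * Ck * Cs = C * Ck * Cs * c₂ ^ (-lam) := by ring
        _ ≤ C * Ck * Cs * c₂⁻¹ := mul_le_mul_of_nonneg_left h1 (by positivity)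
        _ ≤ c / 2 := by rw [← div_eq_mul_inv, div_le_iff₀ hc₂0]; linarith
    -- The estimate gives `c/(2 Cw)`; halving it makes the inequality strict.
    refine ⟨c / (4 * Cw), by positivity, c₂, hc₂0, ?_⟩
    suffices h : ∀ᶠ ε in 𝓝[>] 0, c / (4 * Cw) * ε ^ (4 * r) <
        ∑' j : ℕ+, if (j : ℝ) < c₂ * cutoff ϰ ε then |fourierCoeff φ (S ε) j| ^ 2 else 0 by
      obtain ⟨ε₀, h0, h⟩ := (mem_nhdsGT_iff_exists_Ioo_subset).1 h
      exact ⟨ε₀, h0, fun ε h1 h2 => h ⟨h1, h2⟩⟩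
    filter_upwards [hen, hw, hkap, hs, eventually_one_le_cutoff hk, self_mem_nhdsWithin]
      with ε he hw hkap hs hk1 hε
    have hε : 0 < ε := hε
    have hp : 0 < ε ^ (2 - 4 * r - 2 * w) := Real.rpow_pos_of_pos hε _
    have hr : 0 < ε ^ (4 * r) := Real.rpow_pos_of_pos hε _
    have hu : ∀ j : ℕ+, c₂ * cutoff ϰ ε ≤ j →
        weight ϰ ε j ≤ C * c₂ ^ (-lam) * (Ck * ε ^ (2 - 4 * r - 2 * w)) := fun j hj =>
      (hdec c₂ hc₂1 ε hε hk1 j hj).trans (mul_le_mul_of_nonneg_left hkap (by positivity))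
    have hmain := he.trans (hϰ.energy_le hφ hε (S ε) hw (by positivity) hu)
    set L := ∑' j : ℕ+, if (j : ℝ) < c₂ * cutoff ϰ ε then |fourierCoeff φ (S ε) j| ^ 2 else 0
    rw [← rpow_scaling hε r w] at hmain
    set v := ε ^ (2 - 4 * r - 2 * w) / ε ^ 2 with hv
    have hv0 : 0 < v := by positivity
    have e1 : C * c₂ ^ (-lam) * (Ck * ε ^ (2 - 4 * r - 2 * w)) / ε ^ 2 * ‖S ε‖ ^ 2 ≤
        c / 2 * (v * ε ^ (4 * r)) := by
      calc C * c₂ ^ (-lam) * (Ck * ε ^ (2 - 4 * r - 2 * w)) / ε ^ 2 * ‖S ε‖ ^ 2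
          ≤ C * c₂ ^ (-lam) * (Ck * ε ^ (2 - 4 * r - 2 * w)) / ε ^ 2 * (Cs * ε ^ (4 * r)) :=
            mul_le_mul_of_nonneg_left hs (by positivity)
        _ = C * c₂ ^ (-lam) * Ck * Cs * (v * ε ^ (4 * r)) := by rw [hv]; ring
        _ ≤ _ := mul_le_mul_of_nonneg_right hpow (by positivity)
    have e2 : c / 2 * (v * ε ^ (4 * r)) ≤ Cw * v * L := by
      have : Cw * ε ^ (2 - 4 * r - 2 * w) / ε ^ 2 * L = Cw * v * L := by rw [hv]; ring
      linarith
    have e3 : c / 2 * ε ^ (4 * r) ≤ Cw * L := by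
      refine le_of_mul_le_mul_left ?_ hv0
      linarith
    rw [div_mul_eq_mul_div, div_lt_iff₀ (by positivity)]
    nlinarith [mul_pos hc hr]
  · rintro ⟨c₁, hc₁, c₂, hc₂, ε₀, hε₀, h⟩
    obtain ⟨C, hC, hlow⟩ := hϰ.le_weight_of_lt c₂
    obtain ⟨Ck, hCk, hkap⟩ := exists_le_kappaSq hϰ hk
    refine ⟨C * Ck * c₁, by positivity, ?_⟩
    filter_upwards [hkap, eventually_one_le_cutoff hk, Ioo_mem_nhdsGT hε₀] with ε hkap hk1 hε
    have hsum := h ε hε.1 hε.2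
    have hε : 0 < ε := hε.1
    refine le_trans ?_ (hϰ.le_energy hφ hε (S ε) (v := C * (Ck * ε ^ (2 - 4 * r - 2 * w)))
      fun j hj => (mul_le_mul_of_nonneg_left hkap hC.le).trans (hlow ε hε hk1 j hj))
    have hp : 0 < ε ^ (2 - 4 * r - 2 * w) := Real.rpow_pos_of_pos hε _
    refine le_trans (Eq.le ?_) (mul_le_mul_of_nonneg_left hsum.le (by positivity))
    rw [← rpow_scaling hε r w]
    ring

end

end SignalDetection

end

/-! ### The main equivalence -/

open SignalDetection in
theorem mainTheorem2 {Ω : Type*} [MeasurableSpace Ω] (P : Measure Ω) [IsProbabilityMeasure P]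
    (W : L2 → Ω → ℝ) (hW : IsWhiteNoise P W)
    (φ : ℕ+ → L2) (hφ : Orthonormal ℝ φ)
    (ϰ : ℝ → ℕ+ → ℝ) (hϰ : Conditions ϰ)
    (r w : ℝ) (hr : 0 < r) (hr' : r < 1 / 2) (hw : 0 < 2 * w) (hw' : 2 * w < 1 - 2 * r)
    (hk : (fun ε => (cutoff ϰ ε : ℝ)) =Θ[𝓝[>] 0] fun ε : ℝ => ε ^ (-4 + 8 * r + 4 * w))
    (S : ℝ → L2) (hS : (fun ε => ‖S ε‖) =Θ[𝓝[>] 0] fun ε : ℝ => ε ^ (2 * r)) :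
    IsLDConsistent P W φ ϰ (fun ε => ε ^ (-2 * w)) S ↔
      ∃ c₁ > (0 : ℝ), ∃ c₂ > (0 : ℝ), ∃ ε₀ > (0 : ℝ), ∀ ε : ℝ, 0 < ε → ε < ε₀ →
        c₁ * ε ^ (4 * r) <
          ∑' j : ℕ+, if (j : ℝ) < c₂ * cutoff ϰ ε then |fourierCoeff φ (S ε) j| ^ 2 else 0 := by
  rw [show -4 + 8 * r + 4 * w = -((2 - 4 * r - 2 * w) * 2) by ring] at hk
  have hR : Tendsto (fun ε : ℝ => ε ^ (-2 * w)) (𝓝[>] 0) atTop :=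
    tendsto_rpow_neg_nhdsGT_zero (by linarith)
  -- The positivity required is `2 - 4r - 4ω > 0`, that is, `2ω < 1 - 2r`.
  have hRw := eventually_rpow_mul_weight_le hϰ (a := -2 * w) (by linarith) hk
  rw [← energy_lower_iff hφ hϰ hk hS]
  exact ⟨energy_of_isLDConsistent hW hφ hϰ hR hRw, isLDConsistent_of_energy hW hφ hϰ hR hRw⟩
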